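/- All graphs are finite and simple, and a *graph class* is a class of graphs closed under isomorphism. For a graph class $\mathcal C$ let $\mathcal C_n$ be the set of graphs in $\mathcal C$ with vertex set $[n]=\{1,\dots,n\}$. The class $\mathcal C$ is *small* if there is $d\in\mathbb R$ with $|\mathcal C_n|\le d^n\,n!$ for all $n$. It is *addable* if it is - *decomposable*: a graph $G$ is in $\mathcal C$ if and only if every connected component of $G$ is in $\mathcal C$; and - *bridge-addable*: if $G\in\mathcal C$ and $u,v$ are vertices in distinct connected components of $G$, then the graph obtained from $G$ by adding the edge $\{u,v\}$ is in $\mathcal C$. Formulas of monadic second-order logic (MSO) over graphs are built from the atomic formulas $x\in X$ and $E(x,y)$ (adjacency), where $x,y$ are vertex variables and $X$ is a variable for sets of vertices, by $\wedge,\vee,\neg$ and by universal and existential quantification over vertices and over sets of vertices; a sentence is a formula without free variables, and satisfaction is the usual one. Let $\mathrm{Conn}$ be the class of connected (non-empty) graphs. **Theorem.** Let $\mathcal C$ be a small addable class of graphs that contains at least one graph with a non-empty vertex set, and let $\phi$ be a sentence of MSO. Then $(\mathcal C\cap\mathrm{Conn})_n\neq\emptyset$ for infinitely many $n$. For each such $n$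 let $p_n$ be the probability that a uniformly random element of $(\mathcal C\cap\mathrm{Conn})_n$ satisfies $\phi$. Then, as $n\to\infty$ through the integers $n$ with $(\mathcal C\cap\mathrm{Conn})_n\ne\emptyset$, the limit of $p_n$ exists and is equal to either $0$ or $1$. (In particular $\lim_{n\to\infty}p_n\in\{0,1\}$ in the ordinary sense if $(\mathcal C\cap\mathrm{Conn})_n\ne\emptyset$ for all large $n$, for instance if $\mathcal C$ contains the one-vertex graph.) -/

import Mathlib

open Filter Topology

/-- A class of finite graphs closed under isomorphism. Finite graphs are represented by simple
graphs on finite types; restricting to types in the lowest universe loses nothing, up to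
isomorphism. -/
structure GraphClass where
  /-- `C.Mem V G` says that the graph `G` with vertex set `V` belongs to the class `C`. -/
  Mem : (V : Type) → [Finite V] → SimpleGraph V → Prop
  /-- The class is closed under isomorphism. -/
  iso_closed : ∀ (V W : Type) [Finite V] [Finite W] (G : SimpleGraph V) (H : SimpleGraph W),
    Nonempty (G ≃g H) → Mem V G → Mem W H

namespace GraphClass

/-- The graphs of the class on the fixed `n`-element vertex set `Fin n`. -/
def onFin (C : GraphClass) (n : ℕ) : Set (SimpleGraph (Fin n)) :=
  {G | C.Mem (Fin n) G}

/-- A graph is in the class if and only if all its connected components are. -/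
def Decomposable (C : GraphClass) : Prop :=
  ∀ (V : Type) [Finite V] (G : SimpleGraph V),
    C.Mem V G ↔ ∀ K : G.ConnectedComponent, C.Mem K K.toSimpleGraph

/-- Joining two vertices in distinct connected components of a graph in the class by an edge
gives a graph in the class. -/
def BridgeAddable (C : GraphClass) : Prop :=
  ∀ (V : Type) [Finite V] (G : SimpleGraph V), C.Mem V G →
    ∀ u v : V, G.connectedComponentMk u ≠ G.connectedComponentMk v →
      C.Mem V (G ⊔ SimpleGraph.edge u v)

/-- Decomposable and bridge-addable. -/
def Addable (C : GraphClass) : Prop :=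
  C.Decomposable ∧ C.BridgeAddable

/-- The number of labelled graphs on `n` vertices in the class is at most `d ^ n * n!`. -/
def Small (C : GraphClass) : Prop :=
  ∃ d : ℝ, ∀ n : ℕ, ((C.onFin n).ncard : ℝ) ≤ d ^ n * (n.factorial : ℝ)

/-- The class of connected graphs (the graph without vertices is not connected). -/
def conn : GraphClass where
  Mem _ _ G := G.Connected
  iso_closed _ _ _ _ _ _ := fun ⟨e⟩ h => e.connected_iff.1 h

/-- The intersection of two graph classes. -/
def inter (C D : GraphClass) : GraphClass where
  Mem V _ G := C.Mem V G ∧ D.Mem V G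
  iso_closed V W _ _ G H e h := ⟨C.iso_closed V W G H e h.1, D.iso_closed V W G H e h.2⟩

instance : Inter GraphClass := ⟨inter⟩

end GraphClass

/-- Formulas of monadic second-order logic over graphs. First-order variables and set variables
are two separate copies of `ℕ`. (Equality of vertices is definable: `x = y` if and only if every
set containing `x` contains `y`.) -/
inductive MSOFormula : Type
  /-- `mem x X` is the atomic formula `x ∈ X`. -/
  | mem (x X : ℕ) : MSOFormula
  /-- `adj x y` is the atomic formula `E(x, y)`. -/
  | adj (x y : ℕ) : MSOFormula
  | and (φ ψ : MSOFormula) : MSOFormula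
  | or (φ ψ : MSOFormula) : MSOFormula
  | not (φ : MSOFormula) : MSOFormula
  /-- First-order universal quantification. -/
  | all (x : ℕ) (φ : MSOFormula) : MSOFormula
  /-- First-order existential quantification. -/
  | ex (x : ℕ) (φ : MSOFormula) : MSOFormula
  /-- Universal quantification over sets of vertices. -/
  | allSet (X : ℕ) (φ : MSOFormula) : MSOFormula
  /-- Existential quantification over sets of vertices. -/
  | exSet (X : ℕ) (φ : MSOFormula) : MSOFormula

namespace MSOFormula

/-- The free first-order variables of a formula. -/
def freeVar : MSOFormula → Set ℕ
  | mem x _ => {x}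
  | adj x y => {x, y}
  | and φ ψ => φ.freeVar ∪ ψ.freeVar
  | or φ ψ => φ.freeVar ∪ ψ.freeVar
  | not φ => φ.freeVar
  | all x φ => φ.freeVar \ {x}
  | ex x φ => φ.freeVar \ {x}
  | allSet _ φ => φ.freeVar
  | exSet _ φ => φ.freeVar

/-- The free set variables of a formula. -/
def freeSetVar : MSOFormula → Set ℕ
  | mem _ X => {X}
  | adj _ _ => ∅
  | and φ ψ => φ.freeSetVar ∪ ψ.freeSetVar
  | or φ ψ => φ.freeSetVar ∪ ψ.freeSetVar
  | not φ => φ.freeSetVar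
  | all _ φ => φ.freeSetVar
  | ex _ φ => φ.freeSetVar
  | allSet X φ => φ.freeSetVar \ {X}
  | exSet X φ => φ.freeSetVar \ {X}

/-- A sentence is a formula without free variables. -/
def IsSentence (φ : MSOFormula) : Prop :=
  φ.freeVar = ∅ ∧ φ.freeSetVar = ∅

/-- Satisfaction of a formula in a graph under a valuation, a pair of partial functions from
the variables to the vertices and to the sets of vertices. (An atomic formula with a variable on
which the valuation is undefined counts as false; this is never used for a sentence.) -/
def Sat {V : Type} (G : SimpleGraph V) :
    (ℕ → Option V) → (ℕ → Option (Set V)) → MSOFormula → Prop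
  | σ, τ, mem x X => ∃ v U, σ x = some v ∧ τ X = some U ∧ v ∈ U
  | σ, _, adj x y => ∃ v w, σ x = some v ∧ σ y = some w ∧ G.Adj v w
  | σ, τ, and φ ψ => Sat G σ τ φ ∧ Sat G σ τ ψ
  | σ, τ, or φ ψ => Sat G σ τ φ ∨ Sat G σ τ ψ
  | σ, τ, not φ => ¬ Sat G σ τ φ
  | σ, τ, all x φ => ∀ v : V, Sat G (Function.update σ x (some v)) τ φ
  | σ, τ, ex x φ => ∃ v : V, Sat G (Function.update σ x (some v)) τ φ
  | σ, τ, allSet X φ => ∀ U : Set V, Sat G σ (Function.update τ X (some U)) φ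
  | σ, τ, exSet X φ => ∃ U : Set V, Sat G σ (Function.update τ X (some U)) φ

/-- The graph `G` satisfies the sentence `φ`: satisfaction under the nowhere defined valuation. -/
def Holds {V : Type} (G : SimpleGraph V) (φ : MSOFormula) : Prop :=
  Sat G (fun _ => none) (fun _ => none) φ

end MSOFormula

/-- The probability that a uniformly random graph from `C` on the vertex set `Fin n` satisfies
`φ`. (It is meaningful only if `C` has a graph on `Fin n`.) -/
noncomputable def GraphClass.prob (C : GraphClass) (φ : MSOFormula) (n : ℕ) : ℝ :=
  ({G | G ∈ C.onFin n ∧ MSOFormula.Holds G φ}.ncard : ℝ) / ((C.onFin n).ncard : ℝ)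

/-- The numbers `n` for which `C` has a graph on `Fin n`, that is, for which the uniformly random
graph from `C` on `n` vertices exists. -/
def GraphClass.sizes (C : GraphClass) : Set ℕ :=
  {n | (C.onFin n).Nonempty}

/-!
Let `K` be the class of connected graphs in the small addable class `C`. The theorem holds because
there is a rooted graph `(H, r)` in `K` such that all graphs in `K` with a pendant copy of `H`
(a copy that at most one edge leaves, from the root) agree on `φ`, while almost all graphs in `K`
have such a copy.

*Logic.* The rank-`k` type `SimpleGraph.msoType` of a coloured graph takes values in a finite set
and determines the sentences of quantifier rank less than `k` (`MSOFormula.Matching.sat_iff`). Types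
are composed along disjoint unions and along edges determined by colours (`msoType_glue_bot`,
`msoType_glue_congr`), so that they form a commutative monoid. In rank `0` this monoid is
idempotent, and the monoid in rank `k + 1` consists of sets of elements of one in rank `k`; by the
pigeonhole principle all these monoids are aperiodic: from some `N` on, all multiples of an element
agree. The graph `H` consists of a graph in `K` with a vertex `r` to which `N` copies of each type of
rooted graph in `K` are attached. If `G` and `G'` in `K` have pendant copies of `H`, join their roots by an edge. In the
resulting graph, `G'` is one more rooted graph attached at the root in `G`, so the type is that of
`G`; by symmetry it is also that of `G'` (`exists_universal_pendant`). The part of `G` outside the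
copy need not belong to `C`.

*Counting.* Put `x n = |K_n| / n!`. Two cuts of a connected graph by a single edge whose small sides
have the same size are equal or have disjoint small sides (`CutAtMostOne.eq_or_disjoint`).
Joining two graphs by an edge therefore gives `x i * x j ≤ 2 * x (i + j)`, and with smallness it
follows that `x n` grows like `γ ^ n` along the sizes of `K` (`exists_growth_rate`). Attaching a
copy of `H` to a connected graph that is not smaller creates no other pendant copy, so `p` attached copies
can be recovered from the result. If `y n * n!` is the number of graphs in `K_n` without a pendant
copy of `H`, then `y n * (n / h!) ^ p / p! ≤ x (n + h * p)`. With `p` a small multiple of `n` this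
makes `y n` exponentially smaller than `x n` (`tendsto_div_of_extensions`).
-/

/-! ### Aperiodic finite commutative monoids -/

section Aperiodic

open scoped Pointwise

variable {M : Type*} [AddCommMonoid M]

theorem Set.mem_nsmul_iff_exists_multiset {S : Set M} {n : ℕ} {a : M} :
    a ∈ n • S ↔ ∃ s : Multiset M, s.card = n ∧ (∀ x ∈ s, x ∈ S) ∧ s.sum = a := by
  induction n generalizing a with
  | zero =>
    simp only [zero_nsmul, Set.mem_zero, Multiset.card_eq_zero]
    constructor
    · rintro rfl
      exact ⟨0, rfl, by simp, by simp⟩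
    · rintro ⟨s, rfl, -, h⟩
      simpa using h.symm
  | succ n ih =>
    rw [succ_nsmul, Set.mem_add]
    constructor
    · rintro ⟨x, hx, y, hy, rfl⟩
      obtain ⟨s, hs, hS, rfl⟩ := ih.1 hx
      refine ⟨y ::ₘ s, by simp [hs], ?_, by simp [add_comm]⟩
      intro z hz
      rcases Multiset.mem_cons.1 hz with rfl | hz
      exacts [hy, hS z hz]
    · rintro ⟨s, hs, hS, rfl⟩
      obtain ⟨y, hy⟩ := Multiset.card_pos_iff_exists_mem.1 (by omega : 0 < s.card)
      obtain ⟨t, rfl⟩ := Multiset.exists_cons_of_mem hy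
      refine ⟨t.sum, ih.2 ⟨t, by simpa using hs, fun x hx => hS x (by simp [hx]), rfl⟩,
        y, hS y (by simp), by simp [add_comm]⟩

theorem Multiset.exists_lt_count_of_mul_card_lt {α : Type*} [Finite α] [DecidableEq α]
    {N : ℕ} {s : Multiset α} (h : N * Nat.card α < s.card) : ∃ a, N < s.count a := by
  have := Fintype.ofFinite α
  by_contra! hc
  have h1 : s.card = ∑ a : α, s.count a := by
    rw [← Multiset.toFinset_sum_count_eq]
    exact Finset.sum_subset (Finset.subset_univ _) (by simp)
  have h2 : ∑ a : α, s.count a ≤ ∑ _a : α, N := Finset.sum_le_sum fun a _ => hc a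
  simp only [Finset.sum_const, Finset.card_univ, smul_eq_mul] at h2
  rw [Nat.card_eq_fintype_card, mul_comm] at h
  omega

/-- Aperiodicity passes to the monoid of subsets: in a sum of many elements of a set, one summand
occurs so often that one more or one less occurrence makes no difference. -/
theorem Set.exists_nsmul_stable [Finite M] {N : ℕ} (hN : ∀ t : M, (N + 1) • t = N • t) :
    ∃ K : ℕ, ∀ S : Set M, (K + 1) • S = K • S := by
  classical
  refine ⟨N * Nat.card M + 1, fun S => Set.ext fun a => ?_⟩
  rw [Set.mem_nsmul_iff_exists_multiset, Set.mem_nsmul_iff_exists_multiset]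
  -- By the pigeonhole principle some summand `m` occurs more than `N` times.
  have key : ∀ s : Multiset M, N * Nat.card M < s.card →
      ∃ m r, s = Multiset.replicate (N + 1) m + r := by
    intro s hs
    obtain ⟨m, hm⟩ := Multiset.exists_lt_count_of_mul_card_lt hs
    obtain ⟨r, hr⟩ := Multiset.le_iff_exists_add.1 (Multiset.le_count_iff_replicate_le.1 hm)
    exact ⟨m, r, hr⟩
  constructor
  · rintro ⟨s, hs, hS, rfl⟩
    obtain ⟨m, r, rfl⟩ := key s (by omega)
    refine ⟨Multiset.replicate N m + r, ?_, fun x hx => hS x ?_, ?_⟩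
    · simp only [Multiset.card_add, Multiset.card_replicate] at hs ⊢
      omega
    · rw [Multiset.mem_add] at hx ⊢
      exact hx.imp_left fun h => by
        rw [Multiset.mem_replicate] at h ⊢; exact ⟨by omega, h.2⟩
    · rw [Multiset.sum_add, Multiset.sum_add, Multiset.sum_replicate, Multiset.sum_replicate, hN]
  · rintro ⟨s, hs, hS, rfl⟩
    obtain ⟨m, r, rfl⟩ := key s (by omega)
    refine ⟨Multiset.replicate (N + 1 + 1) m + r, ?_, fun x hx => hS x ?_, ?_⟩
    · simp only [Multiset.card_add, Multiset.card_replicate] at hs ⊢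
      omega
    · rw [Multiset.mem_add] at hx ⊢
      exact hx.imp_left fun h => by
        rw [Multiset.mem_replicate] at h ⊢; exact ⟨by omega, h.2⟩
    · rw [Multiset.sum_add, Multiset.sum_add, Multiset.sum_replicate, Multiset.sum_replicate,
        succ_nsmul m (N + 1), hN, ← succ_nsmul, hN]

/-- If multiples stabilise, then every finite set of elements is absorbed by a sum of elements of
that set. -/
theorem Set.Finite.exists_absorbing_list {N : ℕ} (hN : ∀ t : M, (N + 1) • t = N • t)
    {S : Set M} (hS : S.Finite) :
    ∃ l : List M, (∀ t ∈ l, t ∈ S) ∧ ∀ t ∈ S, l.sum + t = l.sum := by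
  classical
  refine ⟨hS.toFinset.toList.flatMap fun t => List.replicate N t, ?_, fun t ht => ?_⟩
  · intro t ht
    simp only [List.mem_flatMap, Finset.mem_toList, Set.Finite.mem_toFinset,
      List.mem_replicate] at ht
    obtain ⟨a, ha, -, rfl⟩ := ht
    exact ha
  · have hsum : ∀ l : List M, t ∈ l →
        (l.flatMap fun t => List.replicate N t).sum + t
          = (l.flatMap fun t => List.replicate N t).sum := by
      intro l hl
      induction l with
      | nil => simp at hl
      | cons a l ih =>
        simp only [List.flatMap_cons, List.sum_append, List.sum_replicate]
        rcases List.mem_cons.1 hl with rfl | h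
        · rw [add_right_comm, ← succ_nsmul, hN]
        · rw [add_assoc, ih h]
    exact hsum _ (by simpa using ht)

end Aperiodic

/-! ### Monadic second-order types -/

section Types

open scoped Pointwise

/-- The possible rank-`k` types of graphs whose vertices are coloured by `L`. In rank `0` a type
records which colours occur and which pairs of colours occur on adjacent vertices; in rank `k + 1`
it is the set of the rank-`k` types that arise by marking a set of vertices. -/
def MSOType : ℕ → Type → Type
  | 0, L => Set (L ⊕ L × L)
  | k + 1, L => Set (MSOType k (L × Prop))

instance MSOType.instFinite : ∀ (k : ℕ) (L : Type) [Finite L], Finite (MSOType k L)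
  | 0, L, _ => inferInstanceAs (Finite (Set (L ⊕ L × L)))
  | k + 1, L, _ =>
    have := MSOType.instFinite k (L × Prop)
    inferInstanceAs (Finite (Set (MSOType k (L × Prop))))

/-- The commutative monoid of types: union in rank `0`, and elementwise addition in positive rank.
It describes disjoint unions of coloured graphs. -/
instance MSOType.instAddCommMonoid : ∀ (k : ℕ) (L : Type), AddCommMonoid (MSOType k L)
  | 0, L =>
    { add := fun s t => (s ∪ t : Set (L ⊕ L × L))
      zero := (∅ : Set (L ⊕ L × L))
      add_assoc := Set.union_assoc
      zero_add := Set.empty_union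
      add_zero := Set.union_empty
      add_comm := Set.union_comm
      nsmul := @nsmulRec _ ⟨(∅ : Set (L ⊕ L × L))⟩ ⟨fun s t => (s ∪ t : Set (L ⊕ L × L))⟩
      nsmul_zero := fun _ => rfl
      nsmul_succ := fun _ _ => rfl }
  | k + 1, L =>
    letI := MSOType.instAddCommMonoid k (L × Prop)
    (Set.addCommMonoid : AddCommMonoid (Set (MSOType k (L × Prop))))

theorem MSOType.exists_nsmul_stable :
    ∀ (k : ℕ) (L : Type) [Finite L], ∃ N : ℕ, ∀ t : MSOType k L, (N + 1) • t = N • t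
  | 0, L, _ => ⟨1, fun t => by
      rw [succ_nsmul, one_nsmul]
      exact Set.union_self t⟩
  | k + 1, L, _ => by
    obtain ⟨N, hN⟩ := MSOType.exists_nsmul_stable k (L × Prop)
    exact Set.exists_nsmul_stable hN

/-- The rank-`0` type of a graph `G` with colouring `c`. -/
def SimpleGraph.atomicType {L V : Type} (G : SimpleGraph V) (c : V → L) : Set (L ⊕ L × L) :=
  {x | (∃ v, x = .inl (c v)) ∨ ∃ v w, G.Adj v w ∧ x = .inr (c v, c w)}

/-- The rank-`k` type of a graph `G` with colouring `c`. -/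
def SimpleGraph.msoType : (k : ℕ) → {L V : Type} → SimpleGraph V → (V → L) → MSOType k L
  | 0, _, _, G, c => G.atomicType c
  | k + 1, L, V, G, c =>
      (Set.range fun U : Set V => SimpleGraph.msoType k G fun v => (c v, v ∈ U) :
        Set (MSOType k (L × Prop)))

namespace SimpleGraph

variable {L V W V' W' : Type} {k : ℕ}

theorem inl_mem_atomicType {G : SimpleGraph V} {c : V → L} {a : L} :
    .inl a ∈ G.atomicType c ↔ ∃ v, c v = a := by
  simp [atomicType, eq_comm]

theorem inr_mem_atomicType {G : SimpleGraph V} {c : V → L} {a b : L} :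
    .inr (a, b) ∈ G.atomicType c ↔
      ∃ v w, G.Adj v w ∧ c v = a ∧ c w = b := by
  simp [atomicType, eq_comm]

theorem msoType_zero_eq_iff {G : SimpleGraph V} {G' : SimpleGraph V'} {c : V → L} {c' : V' → L} :
    G.msoType 0 c = G'.msoType 0 c' ↔
      (∀ a, (∃ v, c v = a) ↔ ∃ v, c' v = a) ∧
      ∀ a b, (∃ v w, G.Adj v w ∧ c v = a ∧ c w = b) ↔ ∃ v w, G'.Adj v w ∧ c' v = a ∧ c' w = b := by
  change G.atomicType c = G'.atomicType c' ↔ _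
  constructor
  · intro h
    refine ⟨fun a => ?_, fun a b => ?_⟩
    · rw [← inl_mem_atomicType (G := G), h, inl_mem_atomicType]
    · rw [← inr_mem_atomicType, h, inr_mem_atomicType]
  · rintro ⟨h1, h2⟩
    refine Set.ext ?_
    rintro (a | ⟨a, b⟩)
    · rw [inl_mem_atomicType, h1, inl_mem_atomicType]
    · rw [inr_mem_atomicType, h2, inr_mem_atomicType]

/-- Any marking of one of two graphs of the same type can be answered in the other one. -/
theorem exists_msoType_eq_of_succ {G : SimpleGraph V} {G' : SimpleGraph V'} {c : V → L}
    {c' : V' → L} (h : G.msoType (k + 1) c = G'.msoType (k + 1) c') (U : Set V) :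
    ∃ U' : Set V', G.msoType k (fun v => (c v, v ∈ U)) = G'.msoType k fun v => (c' v, v ∈ U') := by
  have h' : (Set.range fun U : Set V => G.msoType k fun v => (c v, v ∈ U))
      = Set.range fun U : Set V' => G'.msoType k fun v => (c' v, v ∈ U) := h
  obtain ⟨U', hU'⟩ := h'.le ⟨U, rfl⟩
  exact ⟨U', hU'.symm⟩

theorem msoType_succ_eq {G : SimpleGraph V} {G' : SimpleGraph V'} {c : V → L} {c' : V' → L}
    (h : ∀ U : Set V, ∃ U' : Set V',
      G.msoType k (fun v => (c v, v ∈ U)) = G'.msoType k fun v => (c' v, v ∈ U'))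
    (h' : ∀ U' : Set V', ∃ U : Set V,
      G.msoType k (fun v => (c v, v ∈ U)) = G'.msoType k fun v => (c' v, v ∈ U')) :
    G.msoType (k + 1) c = G'.msoType (k + 1) c' := by
  refine Set.Subset.antisymm ?_ ?_
  · rintro _ ⟨U, rfl⟩
    obtain ⟨U', hU'⟩ := h U
    exact ⟨U', hU'.symm⟩
  · rintro _ ⟨U', rfl⟩
    obtain ⟨U, hU⟩ := h' U'
    exact ⟨U, hU⟩

theorem msoType_comp_eq {L' : Type} {G : SimpleGraph V} {G' : SimpleGraph V'} {c : V → L}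
    {c' : V' → L} (f : L → L') (h : G.msoType k c = G'.msoType k c') :
    G.msoType k (f ∘ c) = G'.msoType k (f ∘ c') := by
  induction k generalizing L L' with
  | zero =>
    rw [msoType_zero_eq_iff] at h ⊢
    obtain ⟨h1, h2⟩ := h
    refine ⟨fun a => ⟨?_, ?_⟩, fun a b => ⟨?_, ?_⟩⟩
    · rintro ⟨v, rfl⟩
      obtain ⟨w, hw⟩ := (h1 _).1 ⟨v, rfl⟩
      exact ⟨w, by simp [hw]⟩
    · rintro ⟨v, rfl⟩
      obtain ⟨w, hw⟩ := (h1 _).2 ⟨v, rfl⟩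
      exact ⟨w, by simp [hw]⟩
    · rintro ⟨v, w, hvw, rfl, rfl⟩
      obtain ⟨x, y, hxy, hx, hy⟩ := (h2 _ _).1 ⟨v, w, hvw, rfl, rfl⟩
      exact ⟨x, y, hxy, by simp [hx], by simp [hy]⟩
    · rintro ⟨v, w, hvw, rfl, rfl⟩
      obtain ⟨x, y, hxy, hx, hy⟩ := (h2 _ _).2 ⟨v, w, hvw, rfl, rfl⟩
      exact ⟨x, y, hxy, by simp [hx], by simp [hy]⟩
  | succ k ih =>
    refine msoType_succ_eq (fun U => ?_) fun U' => ?_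
    · obtain ⟨U', hU'⟩ := exists_msoType_eq_of_succ h U
      exact ⟨U', ih (Prod.map f id) hU'⟩
    · obtain ⟨U, hU⟩ := exists_msoType_eq_of_succ h.symm U'
      exact ⟨U, ih (Prod.map f id) hU.symm⟩

theorem msoType_eq_of_succ {G : SimpleGraph V} {G' : SimpleGraph V'} {c : V → L} {c' : V' → L}
    (h : G.msoType (k + 1) c = G'.msoType (k + 1) c') : G.msoType k c = G'.msoType k c' := by
  obtain ⟨U', hU'⟩ := exists_msoType_eq_of_succ h ∅
  exact msoType_comp_eq Prod.fst hU'

theorem msoType_eq_of_le {j : ℕ} (hj : j ≤ k) {G : SimpleGraph V} {G' : SimpleGraph V'}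
    {c : V → L} {c' : V' → L} (h : G.msoType k c = G'.msoType k c') :
    G.msoType j c = G'.msoType j c' := by
  induction k, hj using Nat.le_induction with
  | base => exact h
  | succ k _ ih => exact ih (msoType_eq_of_succ h)

theorem msoType_iso {G : SimpleGraph V} {G' : SimpleGraph V'} (e : G ≃g G') (c' : V' → L) :
    G.msoType k (c' ∘ e) = G'.msoType k c' := by
  induction k generalizing L with
  | zero =>
    rw [msoType_zero_eq_iff]
    refine ⟨fun a => e.toEquiv.exists_congr fun v => Iff.rfl, fun a b => ?_⟩
    refine e.toEquiv.exists_congr fun v => e.toEquiv.exists_congr fun w => ?_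
    exact and_congr e.map_adj_iff.symm Iff.rfl
  | succ k ih =>
    refine msoType_succ_eq (fun U => ⟨e.symm ⁻¹' U, ?_⟩) fun U' => ⟨e ⁻¹' U', ?_⟩
    · rw [← ih]
      congr 1
      funext v
      simp
    · rw [← ih]
      rfl

/-! ### Gluing along a set of crossing edges -/

/-- The disjoint union of `G` and `H` together with the edges between them that are given by the
relation `P`. -/
def glue (G : SimpleGraph V) (H : SimpleGraph W) (P : V → W → Prop) : SimpleGraph (V ⊕ W) where
  Adj
    | .inl v, .inl v' => G.Adj v v'
    | .inl v, .inr w => P v w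
    | .inr w, .inl v => P v w
    | .inr w, .inr w' => H.Adj w w'
  symm := ⟨by
    rintro (v | w) (v' | w') h
    exacts [G.symm.symm _ _ h, h, h, H.symm.symm _ _ h]⟩
  loopless := ⟨by
    rintro (v | w) h
    exacts [G.loopless.irrefl _ h, H.loopless.irrefl _ h]⟩

section

variable {G : SimpleGraph V} {H : SimpleGraph W} {P : V → W → Prop} {v v' : V} {w w' : W}

@[simp] theorem glue_adj_inl : (glue G H P).Adj (.inl v) (.inl v') ↔ G.Adj v v' := Iff.rfl
@[simp] theorem glue_adj_inr : (glue G H P).Adj (.inr w) (.inr w') ↔ H.Adj w w' := Iff.rfl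
@[simp] theorem glue_adj_inl_inr : (glue G H P).Adj (.inl v) (.inr w) ↔ P v w := Iff.rfl
@[simp] theorem glue_adj_inr_inl : (glue G H P).Adj (.inr w) (.inl v) ↔ P v w := Iff.rfl

end

theorem elim_prod_mem {c : V → L} {d : W → L} (U : Set (V ⊕ W)) :
    (fun x => (Sum.elim c d x, x ∈ U)) =
      Sum.elim (fun v => (c v, v ∈ Sum.inl ⁻¹' U)) fun w => (d w, w ∈ Sum.inr ⁻¹' U) := by
  funext x
  cases x <;> rfl

/-- Disjoint union of graphs corresponds to addition of types, since marking vertices of a disjoint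
union amounts to marking vertices of both parts. -/
theorem msoType_glue_bot (G : SimpleGraph V) (H : SimpleGraph W) (c : V → L) (d : W → L) :
    (glue G H fun _ _ => False).msoType k (Sum.elim c d) = G.msoType k c + H.msoType k d := by
  induction k generalizing L with
  | zero =>
    change (glue G H fun _ _ => False).atomicType _ = G.atomicType c ∪ H.atomicType d
    refine Set.ext ?_
    rintro (a | ⟨a, b⟩)
    · rw [inl_mem_atomicType, Set.mem_union, inl_mem_atomicType, inl_mem_atomicType]
      simp
    · rw [inr_mem_atomicType, Set.mem_union, inr_mem_atomicType, inr_mem_atomicType]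
      simp
  | succ k ih =>
    refine Set.Subset.antisymm ?_ ?_
    · rintro _ ⟨U, rfl⟩
      refine Set.mem_add.2 ⟨_, ⟨Sum.inl ⁻¹' U, rfl⟩, _, ⟨Sum.inr ⁻¹' U, rfl⟩, ?_⟩
      simp only [elim_prod_mem, ih]
    · intro x hx
      obtain ⟨_, ⟨U, rfl⟩, _, ⟨U', rfl⟩, rfl⟩ := Set.mem_add.1 hx
      refine ⟨Sum.inl '' U ∪ Sum.inr '' U', ?_⟩
      dsimp only
      rw [elim_prod_mem, ih]
      simp [Set.preimage_union, Set.preimage_image_eq _ Sum.inl_injective,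
        Set.preimage_image_eq _ Sum.inr_injective]

/-- The type of a glued graph depends on one of the parts only through its type, if the crossing
edges are determined by the colours of that part. -/
theorem msoType_glue_congr (G : SimpleGraph V) {H : SimpleGraph W} {H' : SimpleGraph W'}
    (c : V → L) {d : W → L} {d' : W' → L} (R : V → L → Prop)
    (h : H.msoType k d = H'.msoType k d') :
    (glue G H fun v w => R v (d w)).msoType k (Sum.elim c d) =
      (glue G H' fun v w => R v (d' w)).msoType k (Sum.elim c d') := by
  induction k generalizing L with
  | zero =>
    rw [msoType_zero_eq_iff] at h ⊢
    obtain ⟨h1, h2⟩ := h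
    have h3 : ∀ p : L → Prop, (∃ w, p (d w)) ↔ ∃ w, p (d' w) := by
      intro p
      constructor
      · rintro ⟨w, hw⟩
        obtain ⟨w', hw'⟩ := (h1 _).1 ⟨w, rfl⟩
        exact ⟨w', by rwa [hw']⟩
      · rintro ⟨w, hw⟩
        obtain ⟨w', hw'⟩ := (h1 _).2 ⟨w, rfl⟩
        exact ⟨w', by rwa [hw']⟩
    refine ⟨fun a => ?_, fun a b => ?_⟩
    · simp only [Sum.exists, Sum.elim_inl, Sum.elim_inr, h1]
    · simp only [Sum.exists, Sum.elim_inl, Sum.elim_inr, glue_adj_inl, glue_adj_inr,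
        glue_adj_inl_inr, glue_adj_inr_inl, exists_or, h2]
      have e1 : (∃ x x_1, R x (d x_1) ∧ c x = a ∧ d x_1 = b) ↔
          ∃ x x_1, R x (d' x_1) ∧ c x = a ∧ d' x_1 = b :=
        exists_congr fun x => h3 fun l => R x l ∧ c x = a ∧ l = b
      have e2 : (∃ x x_1, R x_1 (d x) ∧ d x = a ∧ c x_1 = b) ↔
          ∃ x x_1, R x_1 (d' x) ∧ d' x = a ∧ c x_1 = b :=
        h3 fun l => ∃ x_1, R x_1 l ∧ l = a ∧ c x_1 = b
      rw [e1, e2]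
  | succ k ih =>
    have key : ∀ (U : Set (V ⊕ W)) (U' : Set (V ⊕ W')),
        Sum.inl ⁻¹' U = (Sum.inl ⁻¹' U' : Set V) →
        H.msoType k (fun w => (d w, w ∈ Sum.inr ⁻¹' U)) =
          H'.msoType k (fun w => (d' w, w ∈ Sum.inr ⁻¹' U')) →
        (glue G H fun v w => R v (d w)).msoType k (fun v => (Sum.elim c d v, v ∈ U)) =
          (glue G H' fun v w => R v (d' w)).msoType k (fun v => (Sum.elim c d' v, v ∈ U')) := by
      intro U U' hU hUU'
      rw [elim_prod_mem, elim_prod_mem, hU]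
      exact ih _ (fun v l => R v l.1) hUU'
    refine msoType_succ_eq (fun U => ?_) fun U' => ?_
    · obtain ⟨U', hU'⟩ := exists_msoType_eq_of_succ h (Sum.inr ⁻¹' U)
      refine ⟨Sum.inl '' (Sum.inl ⁻¹' U) ∪ Sum.inr '' U', key _ _ ?_ ?_⟩
      · simp [Set.preimage_union, Set.preimage_image_eq _ Sum.inl_injective]
      · rw [hU']
        simp [Set.preimage_union, Set.preimage_image_eq _ Sum.inr_injective]
    · obtain ⟨U, hU⟩ := exists_msoType_eq_of_succ h.symm (Sum.inr ⁻¹' U')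
      refine ⟨Sum.inl '' (Sum.inl ⁻¹' U') ∪ Sum.inr '' U, key _ _ ?_ ?_⟩
      · simp [Set.preimage_union, Set.preimage_image_eq _ Sum.inl_injective]
      · rw [hU]
        simp [Set.preimage_union, Set.preimage_image_eq _ Sum.inr_injective]

theorem msoType_of_isEmpty [IsEmpty V] (G : SimpleGraph V) (c : V → L) : G.msoType k c = 0 := by
  induction k generalizing L with
  | zero =>
    change G.atomicType c = ∅
    refine Set.eq_empty_of_forall_notMem ?_
    rintro (a | ⟨a, b⟩)
    · rw [inl_mem_atomicType]; simp
    · rw [inr_mem_atomicType]; simp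
  | succ k ih =>
    refine Set.ext fun x => ?_
    constructor
    · rintro ⟨U, rfl⟩
      exact ih _
    · intro hx
      have : x = 0 := hx
      exact ⟨∅, by rw [this]; exact ih _⟩

end SimpleGraph

end Types

/-! ### Formulas are determined by types -/

namespace SimpleGraph

variable {L V V' : Type} {k : ℕ} {G : SimpleGraph V} {G' : SimpleGraph V'} {c : V → L}
  {c' : V' → L}

theorem exists_color_eq (h : G.msoType k c = G'.msoType k c') (v : V) : ∃ v', c' v' = c v :=
  ((msoType_zero_eq_iff.1 (msoType_eq_of_le k.zero_le h)).1 _).1 ⟨v, rfl⟩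

theorem exists_adj_color_eq (h : G.msoType k c = G'.msoType k c') {v w : V} (hvw : G.Adj v w) :
    ∃ v' w', G'.Adj v' w' ∧ c' v' = c v ∧ c' w' = c w :=
  ((msoType_zero_eq_iff.1 (msoType_eq_of_le k.zero_le h)).2 _ _).1 ⟨v, w, hvw, rfl, rfl⟩

/-- From rank `1` on, types distinguish singletons from other sets: a set with two elements is
split by some further set. -/
theorem exists_eq_singleton {v : V} {U' : Set V'}
    (h : G.msoType (k + 1) (fun w => (c w, w ∈ ({v} : Set V))) =
      G'.msoType (k + 1) fun w => (c' w, w ∈ U')) : ∃ v', U' = {v'} := by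
  have hmem : ∀ {w : V} {w' : V'}, (c' w', w' ∈ U') = (c w, w ∈ ({v} : Set V)) →
      (w' ∈ U' ↔ w = v) := fun h => by
    have h2 := (Prod.ext_iff.1 h).2
    simp only [Set.mem_singleton_iff] at h2
    rw [h2]
  obtain ⟨v', hv'⟩ := exists_color_eq h v
  have hvU : v' ∈ U' := (hmem hv').2 rfl
  refine ⟨v', Set.eq_singleton_iff_unique_mem.2 ⟨hvU, fun b hb => ?_⟩⟩
  by_contra hne
  obtain ⟨W, hW⟩ := exists_msoType_eq_of_succ h.symm {v'}
  obtain ⟨x, hx⟩ := exists_color_eq hW v'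
  obtain ⟨y, hy⟩ := exists_color_eq hW b
  rw [Prod.ext_iff] at hx hy
  have hxv : x = v := (hmem hx.1.symm).1 hvU
  have hyv : y = v := (hmem hy.1.symm).1 hb
  have hx2 : (x ∈ W) = (v' ∈ ({v'} : Set V')) := hx.2
  have hy2 : (y ∈ W) = (b ∈ ({v'} : Set V')) := hy.2
  rw [hxv] at hx2
  rw [hyv, hx2] at hy2
  simp [hne] at hy2

end SimpleGraph

namespace MSOFormula

open SimpleGraph

/-- The quantifier rank; first-order and set quantifiers are not distinguished. -/
def rank : MSOFormula → ℕ
  | mem _ _ => 0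
  | adj _ _ => 0
  | and φ ψ => max φ.rank ψ.rank
  | or φ ψ => max φ.rank ψ.rank
  | not φ => φ.rank
  | all _ φ => φ.rank + 1
  | ex _ φ => φ.rank + 1
  | allSet _ φ => φ.rank + 1
  | exSet _ φ => φ.rank + 1

/-- Two valuations match with respect to colourings of the two vertex sets if they are defined for
the same variables and, for each of those, the two values are described by the same set of
colours. -/
structure Matching {L V V' : Type} (c : V → L) (c' : V' → L) (σ : ℕ → Option V)
    (τ : ℕ → Option (Set V)) (σ' : ℕ → Option V') (τ' : ℕ → Option (Set V')) : Prop where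
  vertex : ∀ x, (σ x = none ∧ σ' x = none) ∨ ∃ (P : L → Prop) (v : V) (v' : V'),
    σ x = some v ∧ σ' x = some v' ∧ (∀ w, P (c w) ↔ w = v) ∧ ∀ w, P (c' w) ↔ w = v'
  set : ∀ X, (τ X = none ∧ τ' X = none) ∨ ∃ P : L → Prop,
    τ X = some {w | P (c w)} ∧ τ' X = some {w | P (c' w)}

variable {L V V' : Type} {k : ℕ} {G : SimpleGraph V} {G' : SimpleGraph V'} {c : V → L}
  {c' : V' → L} {σ : ℕ → Option V} {τ : ℕ → Option (Set V)} {σ' : ℕ → Option V'}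
  {τ' : ℕ → Option (Set V')}

theorem Matching.symm (h : Matching c c' σ τ σ' τ') : Matching c' c σ' τ' σ τ where
  vertex x := (h.vertex x).imp And.symm fun ⟨P, v, v', h1, h2, h3, h4⟩ =>
    ⟨P, v', v, h2, h1, h4, h3⟩
  set X := (h.set X).imp And.symm fun ⟨P, h1, h2⟩ => ⟨P, h2, h1⟩

theorem Matching.mark (h : Matching c c' σ τ σ' τ') (U : Set V) (U' : Set V') :
    Matching (fun v => (c v, v ∈ U)) (fun v => (c' v, v ∈ U')) σ τ σ' τ' where
  vertex x := (h.vertex x).imp_right fun ⟨P, v, v', h1⟩ => ⟨fun l => P l.1, v, v', h1⟩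
  set X := (h.set X).imp_right fun ⟨P, h1⟩ => ⟨fun l => P l.1, h1⟩

theorem Matching.update_set (h : Matching c c' σ τ σ' τ') (X : ℕ) (U : Set V) (U' : Set V') :
    Matching (fun v => (c v, v ∈ U)) (fun v => (c' v, v ∈ U')) σ (Function.update τ X (some U))
      σ' (Function.update τ' X (some U')) where
  vertex := (h.mark U U').vertex
  set Y := by
    rcases eq_or_ne Y X with rfl | hY
    · exact Or.inr ⟨fun l => l.2, by simp, by simp⟩
    · simpa [Function.update_of_ne hY] using (h.mark U U').set Y

theorem Matching.update_vertex (h : Matching c c' σ τ σ' τ') (x : ℕ) (v : V) (v' : V') :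
    Matching (fun w => (c w, w ∈ ({v} : Set V))) (fun w => (c' w, w ∈ ({v'} : Set V')))
      (Function.update σ x (some v)) τ (Function.update σ' x (some v')) τ' where
  set := (h.mark {v} {v'}).set
  vertex y := by
    rcases eq_or_ne y x with rfl | hy
    · exact Or.inr ⟨fun l => l.2, v, v', by simp, by simp, by simp, by simp⟩
    · simpa only [Function.update_of_ne hy] using (h.mark {v} {v'}).vertex y

theorem Matching.sat_mem (h : Matching c c' σ τ σ' τ') (ht : G.msoType k c = G'.msoType k c')
    {x X : ℕ} (hs : Sat G σ τ (mem x X)) : Sat G' σ' τ' (mem x X) := by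
  obtain ⟨v, U, hv, hU, hvU⟩ := hs
  rcases h.vertex x with ⟨h1, -⟩ | ⟨P, w, w', h1, h2, h3, h4⟩
  · simp [h1] at hv
  rcases h.set X with ⟨h5, -⟩ | ⟨Q, h5, h6⟩
  · simp [h5] at hU
  obtain rfl : w = v := by simpa [h1] using hv
  rw [h5, Option.some_inj] at hU
  rw [← hU] at hvU
  obtain ⟨u, hu⟩ := exists_color_eq ht w
  have huw : u = w' := (h4 u).1 (by rw [hu]; exact (h3 w).2 rfl)
  refine ⟨w', _, h2, h6, ?_⟩
  change Q (c' w')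
  rw [← huw, hu]
  exact hvU

theorem Matching.sat_adj (h : Matching c c' σ τ σ' τ') (ht : G.msoType k c = G'.msoType k c')
    {x y : ℕ} (hs : Sat G σ τ (adj x y)) : Sat G' σ' τ' (adj x y) := by
  obtain ⟨v, w, hv, hw, hvw⟩ := hs
  rcases h.vertex x with ⟨h1, -⟩ | ⟨P, a, a', h1, h2, h3, h4⟩
  · simp [h1] at hv
  rcases h.vertex y with ⟨h5, -⟩ | ⟨Q, b, b', h5, h6, h7, h8⟩
  · simp [h5] at hw
  obtain rfl : a = v := by simpa [h1] using hv
  obtain rfl : b = w := by simpa [h5] using hw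
  obtain ⟨p, q, hpq, hp, hq⟩ := exists_adj_color_eq ht hvw
  have hpa : p = a' := (h4 p).1 (by rw [hp]; exact (h3 a).2 rfl)
  have hqb : q = b' := (h8 q).1 (by rw [hq]; exact (h7 b).2 rfl)
  exact ⟨a', b', h2, h6, hpa ▸ hqb ▸ hpq⟩

theorem Matching.exists_vertex (h : Matching c c' σ τ σ' τ')
    (ht : G.msoType (k + 2) c = G'.msoType (k + 2) c') (x : ℕ) (v : V) :
    ∃ v' : V', G.msoType (k + 1) (fun w => (c w, w ∈ ({v} : Set V))) =
        G'.msoType (k + 1) (fun w => (c' w, w ∈ ({v'} : Set V'))) ∧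
      Matching (fun w => (c w, w ∈ ({v} : Set V))) (fun w => (c' w, w ∈ ({v'} : Set V')))
        (Function.update σ x (some v)) τ (Function.update σ' x (some v')) τ' := by
  obtain ⟨U', hU'⟩ := exists_msoType_eq_of_succ ht {v}
  obtain ⟨v', rfl⟩ := exists_eq_singleton hU'
  exact ⟨v', hU', h.update_vertex x v v'⟩

/-- Types of rank greater than the quantifier rank of `φ` determine whether `φ` is satisfied. The
additional rank serves to recognise singletons, so that vertex quantifiers can be treated as set
quantifiers. -/
theorem Matching.sat_iff (φ : MSOFormula) {L V V' : Type} {k : ℕ} {G : SimpleGraph V}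
    {G' : SimpleGraph V'} {c : V → L} {c' : V' → L} {σ : ℕ → Option V} {τ : ℕ → Option (Set V)}
    {σ' : ℕ → Option V'} {τ' : ℕ → Option (Set V')} (h : Matching c c' σ τ σ' τ')
    (hk : φ.rank ≤ k) (ht : G.msoType (k + 1) c = G'.msoType (k + 1) c') :
    Sat G σ τ φ ↔ Sat G' σ' τ' φ := by
  induction φ generalizing L k σ τ σ' τ' with
  | mem x X => exact ⟨h.sat_mem ht, h.symm.sat_mem ht.symm⟩
  | adj x y => exact ⟨h.sat_adj ht, h.symm.sat_adj ht.symm⟩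
  | and φ ψ ih1 ih2 =>
    exact and_congr (ih1 h ((le_max_left _ _).trans hk) ht)
      (ih2 h ((le_max_right _ _).trans hk) ht)
  | or φ ψ ih1 ih2 =>
    exact or_congr (ih1 h ((le_max_left _ _).trans hk) ht)
      (ih2 h ((le_max_right _ _).trans hk) ht)
  | not φ ih => exact not_congr (ih h hk ht)
  | all x φ ih =>
    obtain ⟨k, rfl⟩ : ∃ j, k = j + 1 := Nat.exists_eq_add_one.2 (by simp only [rank] at hk; omega)
    simp only [rank, add_le_add_iff_right] at hk
    constructor
    · intro hs v'
      obtain ⟨v, ht', hm⟩ := h.symm.exists_vertex ht.symm x v'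
      exact (ih hm.symm hk ht'.symm).1 (hs v)
    · intro hs v
      obtain ⟨v', ht', hm⟩ := h.exists_vertex ht x v
      exact (ih hm hk ht').2 (hs v')
  | ex x φ ih =>
    obtain ⟨k, rfl⟩ : ∃ j, k = j + 1 := Nat.exists_eq_add_one.2 (by simp only [rank] at hk; omega)
    simp only [rank, add_le_add_iff_right] at hk
    constructor
    · rintro ⟨v, hs⟩
      obtain ⟨v', ht', hm⟩ := h.exists_vertex ht x v
      exact ⟨v', (ih hm hk ht').1 hs⟩
    · rintro ⟨v', hs⟩
      obtain ⟨v, ht', hm⟩ := h.symm.exists_vertex ht.symm x v'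
      exact ⟨v, (ih hm.symm hk ht'.symm).2 hs⟩
  | allSet X φ ih =>
    obtain ⟨k, rfl⟩ : ∃ j, k = j + 1 := Nat.exists_eq_add_one.2 (by simp only [rank] at hk; omega)
    simp only [rank, add_le_add_iff_right] at hk
    constructor
    · intro hs U'
      obtain ⟨U, ht'⟩ := exists_msoType_eq_of_succ ht.symm U'
      exact (ih (h.update_set X U U') hk ht'.symm).1 (hs U)
    · intro hs U
      obtain ⟨U', ht'⟩ := exists_msoType_eq_of_succ ht U
      exact (ih (h.update_set X U U') hk ht').2 (hs U')
  | exSet X φ ih =>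
    obtain ⟨k, rfl⟩ : ∃ j, k = j + 1 := Nat.exists_eq_add_one.2 (by simp only [rank] at hk; omega)
    simp only [rank, add_le_add_iff_right] at hk
    constructor
    · rintro ⟨U, hs⟩
      obtain ⟨U', ht'⟩ := exists_msoType_eq_of_succ ht U
      exact ⟨U', (ih (h.update_set X U U') hk ht').1 hs⟩
    · rintro ⟨U', hs⟩
      obtain ⟨U, ht'⟩ := exists_msoType_eq_of_succ ht.symm U'
      exact ⟨U, (ih (h.update_set X U U') hk ht'.symm).2 hs⟩

theorem holds_iff_of_msoType_eq {φ : MSOFormula} (hk : φ.rank ≤ k)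
    (ht : G.msoType (k + 1) c = G'.msoType (k + 1) c') : Holds G φ ↔ Holds G' φ :=
  Matching.sat_iff φ ⟨fun _ => Or.inl ⟨rfl, rfl⟩, fun _ => Or.inl ⟨rfl, rfl⟩⟩ hk ht

end MSOFormula

/-! ### Pendant copies and absorption -/

namespace GraphClass

open SimpleGraph

variable {C : GraphClass}

theorem mem_of_iso {V W : Type} [Finite V] [Finite W] {G : SimpleGraph V} {H : SimpleGraph W}
    (e : G ≃g H) (h : C.Mem V G) : C.Mem W H := C.iso_closed V W G H ⟨e⟩ h

theorem Decomposable.mem_sum (hC : C.Decomposable) {V W : Type} [Finite V] [Finite W]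
    {G : SimpleGraph V} {H : SimpleGraph W} (hG : (C ∩ conn).Mem V G)
    (hH : (C ∩ conn).Mem W H) : C.Mem (V ⊕ W) (G ⊕g H) := by
  rw [hC]
  intro K
  induction K using ConnectedComponent.ind with | _ x
  rcases x with v | w
  · have hmem : ∀ v', (Sum.inl v' : V ⊕ W) ∈ (G ⊕g H).connectedComponentMk (.inl v) := fun v' =>
      ConnectedComponent.sound ((hG.2.preconnected v' v).map Embedding.sumInl.toHom)
    refine mem_of_iso (G := G) ⟨Equiv.ofBijective (fun v' => ⟨.inl v', hmem v'⟩) ⟨?_, ?_⟩, ?_⟩ hG.1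
    · intro a b hab
      simpa using hab
    · rintro ⟨a | b, hab⟩
      · exact ⟨a, rfl⟩
      · exact absurd (ConnectedComponent.exact hab).symm (not_reachable_sum_inl_inr _ _)
    · intro a b
      exact sum_adj_inl (G := G) (H := H)
  · have hmem : ∀ w', (Sum.inr w' : V ⊕ W) ∈ (G ⊕g H).connectedComponentMk (.inr w) := fun w' =>
      ConnectedComponent.sound ((hH.2.preconnected w' w).map Embedding.sumInr.toHom)
    refine mem_of_iso (G := H) ⟨Equiv.ofBijective (fun w' => ⟨.inr w', hmem w'⟩) ⟨?_, ?_⟩, ?_⟩ hH.1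
    · intro a b hab
      simpa using hab
    · rintro ⟨a | b, hab⟩
      · exact absurd (ConnectedComponent.exact hab) (not_reachable_sum_inl_inr _ _)
      · exact ⟨b, rfl⟩
    · intro a b
      exact sum_adj_inr (G := G) (H := H)

/-- Connected members of an addable class can be joined by an edge. -/
theorem Addable.mem_glue (hC : C.Addable) {V W : Type} [Finite V] [Finite W]
    {G : SimpleGraph V} {H : SimpleGraph W} (hG : (C ∩ conn).Mem V G)
    (hH : (C ∩ conn).Mem W H) (v : V) (w : W) :
    (C ∩ conn).Mem (V ⊕ W) (glue G H fun x y => x = v ∧ y = w) := by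
  have e : (glue G H fun x y => x = v ∧ y = w) = (G ⊕g H) ⊔ edge (.inl v) (.inr w) := by
    ext (a | a) (b | b) <;> simp [edge_adj, and_comm]
  rw [e]
  refine ⟨hC.2 _ _ (hC.1.mem_sum hG hH) _ _ fun h => ?_, hG.2.sum_sup_edge hH.2⟩
  exact not_reachable_sum_inl_inr _ _ (ConnectedComponent.exact h)

theorem Addable.exists_mem_conn (hC : C.Addable)
    (hne : ∃ (V : Type) (_ : Finite V) (_ : Nonempty V) (G : SimpleGraph V), C.Mem V G) :
    ∃ (V : Type) (_ : Finite V) (G : SimpleGraph V), (C ∩ conn).Mem V G := by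
  obtain ⟨V, _, ⟨v⟩, G, hG⟩ := hne
  exact ⟨_, inferInstance, (G.connectedComponentMk v).toSimpleGraph, (hC.1 V G).1 hG _,
    (G.connectedComponentMk v).connected_toSimpleGraph⟩

end GraphClass

namespace SimpleGraph

variable {V W X : Type}

/-- The induced copy `f` of `H` in `G` is pendant at its root `r`: the only edge, if any, that leaves
the copy does so from the root. -/
def IsPendant {H : SimpleGraph W} {G : SimpleGraph V} (r : W) (f : H ↪g G) : Prop :=
  ∃ v, ∀ w, ∀ b ∉ Set.range f, G.Adj (f w) b → w = r ∧ b = v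

/-- If `G` contains a pendant copy of a graph obtained from `A` by attaching the graph `B` at the
root, then `G` itself is obtained from some graph by attaching `B` in the same way. -/
theorem IsPendant.exists_iso_glue {A : SimpleGraph X} {B : SimpleGraph W} {D : W → Prop} {r : X}
    {G : SimpleGraph V} {f : glue A B (fun x w => x = r ∧ D w) ↪g G} (hf : IsPendant (.inl r) f) :
    ∃ (Y : Type) (A' : SimpleGraph Y) (a : Y) (e : glue A' B (fun y w => y = a ∧ D w) ≃g G),
      e (.inl a) = f (.inl r) := by
  classical
  let g : W → V := fun w => f (.inr w)
  have hg : Function.Injective g := f.injective.comp Sum.inr_injective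
  -- Only the copy of `B` is cut off; the copy of `A` stays in the remaining graph.
  let e : ↥(Set.range g)ᶜ ⊕ W ≃ V :=
    ((Equiv.refl _).sumCongr (Equiv.ofInjective g hg)).trans
      ((Equiv.sumComm _ _).trans (Equiv.Set.sumCompl (Set.range g)))
  have el : ∀ y, e (.inl y) = y := fun y => by simp [e]
  have er : ∀ w, e (.inr w) = f (.inr w) := fun w => by simp [e, g]
  have ha : f (.inl r) ∈ (Set.range g)ᶜ := by
    rintro ⟨w, hw⟩
    exact Sum.inr_ne_inl (f.injective hw)
  have hcross : ∀ (y : ↥(Set.range g)ᶜ) (w : W),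
      G.Adj y (f (.inr w)) ↔ y = ⟨f (.inl r), ha⟩ ∧ D w := by
    rintro ⟨y, hy⟩ w
    rw [Subtype.mk.injEq]
    by_cases hyf : y ∈ Set.range f
    · obtain ⟨x | w', rfl⟩ := hyf
      · rw [f.map_adj_iff, glue_adj_inl_inr, f.injective.eq_iff, Sum.inl.injEq]
      · exact absurd ⟨w', rfl⟩ hy
    · obtain ⟨v, hv⟩ := hf
      constructor
      · intro h
        exact absurd (hv _ y hyf h.symm).1 (by simp)
      · rintro ⟨rfl, -⟩
        exact absurd ⟨_, rfl⟩ hyf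
  refine ⟨↥(Set.range g)ᶜ, G.induce _, ⟨f (.inl r), ha⟩, ⟨e, ?_⟩, ?_⟩
  · rintro (y | w) (y' | w')
    · rw [el, el]; rfl
    · rw [el, er, hcross]; rfl
    · rw [el, er, G.adj_comm, hcross]; rfl
    · rw [er, er, f.map_adj_iff]; rfl
  · exact el _

end SimpleGraph

namespace GraphClass

open SimpleGraph

/-- The rank-`k` types of graphs of `C` in which one vertex, the root, is distinguished by its
colour. -/
def rootedTypes (C : GraphClass) (k : ℕ) : Set (MSOType k Prop) :=
  {t | ∃ (V : Type) (_ : Finite V) (G : SimpleGraph V) (r : V),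
    C.Mem V G ∧ G.msoType k (fun v => v = r) = t}

variable {C : GraphClass} {k : ℕ}

/-- Every sum of rooted types is the type of a disjoint union of rooted graphs that can be attached
to any vertex of a connected member of the class. -/
theorem Addable.exists_attachable (hC : C.Addable) (l : List (MSOType k Prop))
    (hl : ∀ t ∈ l, t ∈ (C ∩ conn).rootedTypes k) :
    ∃ (W : Type) (_ : Finite W) (B : SimpleGraph W) (D : W → Prop), B.msoType k D = l.sum ∧
      ∀ (V : Type) [Finite V] (A : SimpleGraph V) (a : V), (C ∩ conn).Mem V A →
        (C ∩ conn).Mem (V ⊕ W) (glue A B fun v w => v = a ∧ D w) := by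
  induction l with
  | nil =>
    refine ⟨Empty, inferInstance, ⊥, fun _ => False, by simp [msoType_of_isEmpty],
      fun V _ A a hA => ?_⟩
    refine mem_of_iso (G := A) ⟨(Equiv.sumEmpty V Empty).symm, ?_⟩ hA
    intro x y
    rfl
  | cons t l ih =>
    obtain ⟨W, _, B, D, hB, hBA⟩ := ih fun t ht => hl t (List.mem_cons_of_mem _ ht)
    obtain ⟨X, _, G, r, hG, rfl⟩ := hl t List.mem_cons_self
    refine ⟨X ⊕ W, inferInstance, glue G B fun _ _ => False, Sum.elim (fun x => x = r) D, ?_,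
      fun V _ A a hA => ?_⟩
    · rw [msoType_glue_bot, hB, List.sum_cons]
    · refine mem_of_iso ⟨Equiv.sumAssoc V X W, ?_⟩
        (hBA _ _ (.inl a) (hC.mem_glue hA hG a r))
      rintro ((v | x) | w) ((v' | x') | w') <;> simp

/-- If the colours of `B` absorb the type of the rooted graph `(X, x)`, then joining `x` by an edge
to the vertex at which `B` is attached does not change the type. -/
theorem msoType_glue_of_absorbing {Y W X : Type} (A : SimpleGraph Y) (B : SimpleGraph W)
    (D : W → Prop) (a : Y) (H : SimpleGraph X) (x : X)
    (h : B.msoType k D + H.msoType k (fun y => y = x) = B.msoType k D) :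
    (glue (glue A B fun y w => y = a ∧ D w) H fun v y => v = .inl a ∧ y = x).msoType k
        (fun _ => True) =
      (glue A B fun y w => y = a ∧ D w).msoType k fun _ => True := by
  let e : (glue (glue A B fun y w => y = a ∧ D w) H fun v y => v = .inl a ∧ y = x) ≃g
      glue A (glue B H fun _ _ => False) fun y w => y = a ∧ Sum.elim D (fun y => y = x) w :=
    ⟨Equiv.sumAssoc Y W X, by rintro ((v | x) | w) ((v' | x') | w') <;> simp⟩
  rw [← msoType_glue_bot] at h
  have h2 := msoType_comp_eq (fun _ => True) (msoType_glue_congr A (fun _ => True)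
    (fun y d => y = a ∧ d) h)
  exact (msoType_iso e fun _ => True).trans h2

/-- For every rank there is a rooted connected member of the class such that all connected members
that contain a pendant copy of it have the same type. It arises by attaching sufficiently many
copies of each rooted type to the root `r` of some connected member. Given two members `G` and `G'` with pendant copies, let
`J` arise by joining the roots of these copies by an edge; then `J` has the type of `G`, since the
copy in `G` absorbs the whole of `G'`, and likewise the type of `G'`. -/
theorem Addable.exists_universal_pendant (hC : C.Addable)
    (hne : ∃ (V : Type) (_ : Finite V) (G : SimpleGraph V), (C ∩ conn).Mem V G) (k : ℕ) :
    ∃ (h : ℕ) (H : SimpleGraph (Fin h)) (r : Fin h), (C ∩ conn).Mem (Fin h) H ∧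
      ∀ (V V' : Type) [Finite V] [Finite V'] (G : SimpleGraph V) (G' : SimpleGraph V')
        (f : H ↪g G) (f' : H ↪g G'), (C ∩ conn).Mem V G → (C ∩ conn).Mem V' G' →
        IsPendant r f → IsPendant r f' →
        G.msoType k (fun _ => True) = G'.msoType k fun _ => True := by
  obtain ⟨N, hN⟩ := MSOType.exists_nsmul_stable k Prop
  obtain ⟨l, hl, habs⟩ := ((C ∩ conn).rootedTypes k).toFinite.exists_absorbing_list hN
  obtain ⟨W, _, B, D, hB, hBA⟩ := hC.exists_attachable l hl
  obtain ⟨X, _, A, hA⟩ := hne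
  obtain ⟨r⟩ := hA.2.nonempty
  obtain ⟨h, ⟨e⟩⟩ := Finite.exists_equiv_fin (X ⊕ W)
  let M := glue A B fun x w => x = r ∧ D w
  let i : M ≃g M.map e.toEmbedding := Iso.map e M
  refine ⟨h, M.map e.toEmbedding, e (.inl r), mem_of_iso i (hBA X A r hA), ?_⟩
  have absorb : ∀ (V V' : Type) [Finite V] [Finite V'] (G : SimpleGraph V) (G' : SimpleGraph V')
      (f : M.map e.toEmbedding ↪g G) (v : V'), (C ∩ conn).Mem V' G' →
      IsPendant (e (.inl r)) f →
      (glue G G' fun x y => x = f (e (.inl r)) ∧ y = v).msoType k (fun _ => True) =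
        G.msoType k fun _ => True := by
    intro V V' _ _ G G' f v hG' hf
    have hf' : IsPendant (.inl r) (f.comp i.toEmbedding) := by
      obtain ⟨u, hu⟩ := hf
      refine ⟨u, fun w b hb hwb => ?_⟩
      have hb' : b ∉ Set.range f := by
        rintro ⟨x, rfl⟩
        exact hb ⟨i.symm x, congrArg f (i.apply_symm_apply x)⟩
      have := hu (e w) b hb' hwb
      exact ⟨e.injective this.1, this.2⟩
    obtain ⟨Y, A', a, j, hj⟩ := hf'.exists_iso_glue
    have key := msoType_glue_of_absorbing (k := k) A' B D a G' v
      (by rw [hB]; exact habs _ ⟨V', inferInstance, G', v, hG', rfl⟩)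
    have hja : j (.inl a) = f (e (.inl r)) := hj
    let j' : (glue (glue A' B fun y w => y = a ∧ D w) G' fun x y => x = .inl a ∧ y = v) ≃g
        glue G G' fun x y => x = f (e (.inl r)) ∧ y = v :=
      ⟨j.toEquiv.sumCongr (Equiv.refl _), by
        rintro (x | x) (y | y)
        · exact j.map_adj_iff
        · simp [← hja]
        · simp [← hja]
        · simp⟩
    rw [← msoType_iso j', ← msoType_iso j]
    exact key
  intro V V' _ _ G G' f f' hG hG' hf hf'
  rw [← absorb V V' G G' f (f' (e (.inl r))) hG' hf,
    ← absorb V' V G' G f' (f (e (.inl r))) hG hf']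
  let s : (glue G G' fun x y => x = f (e (.inl r)) ∧ y = f' (e (.inl r))) ≃g
      glue G' G fun x y => x = f' (e (.inl r)) ∧ y = f (e (.inl r)) :=
    ⟨Equiv.sumComm _ _, by rintro (x | x) (y | y) <;> simp [and_comm]⟩
  exact msoType_iso s fun _ => True

end GraphClass

/-! ### Cuts with a single edge -/

namespace SimpleGraph

variable {V W X Y : Type}

/-- At most one edge leaves the set `S`. -/
def CutAtMostOne (G : SimpleGraph V) (S : Set V) : Prop :=
  ∃ u v, ∀ a ∈ S, ∀ b ∉ S, G.Adj a b → a = u ∧ b = v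

theorem exists_adj_of_preconnected_induce {G : SimpleGraph V} {S T : Set V}
    (hS : (G.induce S).Preconnected) {a b : V} (ha : a ∈ S) (haT : a ∈ T) (hb : b ∈ S)
    (hbT : b ∉ T) : ∃ x ∈ S, ∃ y ∈ S, x ∈ T ∧ y ∉ T ∧ G.Adj x y := by
  obtain ⟨p⟩ := hS ⟨a, ha⟩ ⟨b, hb⟩
  obtain ⟨d, -, h1, h2⟩ := p.exists_boundary_dart (Subtype.val ⁻¹' T) haT hbT
  exact ⟨d.fst, d.fst.2, d.snd, d.snd.2, h1, h2, d.adj⟩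

/-- If both `S` and its complement are connected and meet both sides of the cut given by `T`, then
at least two edges leave `T`, one inside `S` and one outside. Hence two such cuts with small sides
of equal size are equal or have disjoint small sides. -/
theorem CutAtMostOne.eq_or_disjoint [Finite V] {G : SimpleGraph V} {S T : Set V}
    (hT : G.CutAtMostOne T) (hS : (G.induce S).Preconnected) (hS' : (G.induce Sᶜ).Preconnected)
    (hcard : T.ncard = S.ncard) (hle : S.ncard ≤ Sᶜ.ncard) : T = S ∨ Disjoint S T := by
  by_cases h1 : Disjoint S T
  · exact Or.inr h1
  by_cases h2 : S ⊆ T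
  · exact Or.inl (Set.eq_of_subset_of_ncard_le h2 hcard.le).symm
  by_cases h3 : T ⊆ S
  · exact Or.inl (Set.eq_of_subset_of_ncard_le h3 hcard.ge)
  by_cases h4 : Sᶜ ⊆ T
  · have := Set.eq_of_subset_of_ncard_le h4 (hcard.le.trans hle)
    exact absurd (this ▸ disjoint_compl_right) h1
  obtain ⟨a, haS, haT⟩ := Set.not_disjoint_iff.1 h1
  obtain ⟨b, hbS, hbT⟩ := Set.not_subset.1 h2
  obtain ⟨a', haT', haS'⟩ := Set.not_subset.1 h3
  obtain ⟨b', hbS', hbT'⟩ := Set.not_subset.1 h4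
  obtain ⟨x, hxS, y, hyS, hx, hy, hxy⟩ := exists_adj_of_preconnected_induce hS haS haT hbS hbT
  obtain ⟨x', hxS', y', hyS', hx', hy', hxy'⟩ :=
    exists_adj_of_preconnected_induce hS' haS' haT' hbS' hbT'
  obtain ⟨u, v, huv⟩ := hT
  have e1 := (huv x hx y hy hxy).1
  have e2 := (huv x' hx' y' hy' hxy').1
  exact absurd (e1.trans e2.symm ▸ hxS) hxS'

theorem Connected.induce_range {A : SimpleGraph X} (hA : A.Connected) {G : SimpleGraph V}
    (f : A →g G) : (G.induce (Set.range f)).Connected := by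
  refine hA.map (H := G.induce (Set.range f))
    ⟨fun x => ⟨f x, x, rfl⟩, fun h => f.map_rel h⟩ ?_
  rintro ⟨_, x, rfl⟩
  exact ⟨x, rfl⟩

/-- The graph on `V` made of copies of `A` and `B` on the two parts of a partition of `V`, joined by
the single edge between `u` and `v`. -/
def attachAt (e : X ⊕ Y ≃ V) (A : SimpleGraph X) (B : SimpleGraph Y) (u : X) (v : Y) :
    SimpleGraph V :=
  (glue A B fun x y => x = u ∧ y = v).map e.toEmbedding

section AttachAt

variable {e : X ⊕ Y ≃ V} {A : SimpleGraph X} {B : SimpleGraph Y} {u : X} {v : Y}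

theorem attachAt_adj {x y : X ⊕ Y} :
    (attachAt e A B u v).Adj (e x) (e y) ↔ (glue A B fun x y => x = u ∧ y = v).Adj x y :=
  map_adj_apply (f := e.toEmbedding)

/-- The isomorphism between the glued graph and its copy on `V`. -/
def attachAtIso (e : X ⊕ Y ≃ V) (A : SimpleGraph X) (B : SimpleGraph Y) (u : X) (v : Y) :
    (glue A B fun x y => x = u ∧ y = v) ≃g attachAt e A B u v :=
  Iso.map e _

theorem compl_range_inl (e : X ⊕ Y ≃ V) :
    (Set.range fun x => e (.inl x))ᶜ = Set.range fun y => e (.inr y) := by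
  ext z
  obtain ⟨x | y, rfl⟩ := e.surjective z <;> simp

theorem induce_attachAt_left (hA : A.Connected) :
    ((attachAt e A B u v).induce (Set.range fun x => e (.inl x))).Connected :=
  hA.induce_range (G := attachAt e A B u v) ⟨fun x => e (.inl x), fun h => attachAt_adj.2 h⟩

theorem induce_attachAt_right (hB : B.Connected) :
    ((attachAt e A B u v).induce (Set.range fun x => e (.inl x))ᶜ).Connected := by
  rw [compl_range_inl]
  exact hB.induce_range (G := attachAt e A B u v)
    ⟨fun y => e (.inr y), fun h => attachAt_adj.2 h⟩

theorem cutAtMostOne_attachAt :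
    (attachAt e A B u v).CutAtMostOne (Set.range fun x => e (.inl x)) := by
  refine ⟨e (.inl u), e (.inr v), ?_⟩
  rintro _ ⟨x, rfl⟩ b hb hxb
  obtain ⟨x' | y, rfl⟩ := e.surjective b
  · exact absurd ⟨x', rfl⟩ hb
  · obtain ⟨rfl, rfl⟩ := attachAt_adj.1 hxb
    exact ⟨rfl, rfl⟩

theorem attachAt_injective {A' : SimpleGraph X} {B' : SimpleGraph Y} {u' : X} {v' : Y}
    (h : attachAt e A B u v = attachAt e A' B' u' v') : A = A' ∧ B = B' ∧ u = u' ∧ v = v' := by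
  have key : ∀ x y, (glue A B fun x y => x = u ∧ y = v).Adj x y ↔
      (glue A' B' fun x y => x = u' ∧ y = v').Adj x y := fun x y => by
    rw [← attachAt_adj (e := e), h, attachAt_adj]
  refine ⟨?_, ?_, (key (.inl u) (.inr v)).1 ⟨rfl, rfl⟩⟩
  · ext x y
    exact key (.inl x) (.inl y)
  · ext x y
    exact key (.inr x) (.inr y)

end AttachAt

theorem ncard_range_of_injective [Finite X] {f : X → V} (hf : Function.Injective f) :
    (Set.range f).ncard = Nat.card X := by
  rw [← Set.image_univ, Set.ncard_image_of_injective _ hf, Set.ncard_univ]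

/-! ### Counting graphs by attaching pieces -/

/-- The double counting behind both estimates below. Data in `T` are placed on all splittings of
the labels into `h` and `N` labels; a resulting graph together with the set of the `h` labels
determines the data, and each graph arises with at most `D` such sets. -/
theorem choose_mul_ncard_le {h N D : ℕ}
    (T : Set (SimpleGraph (Fin h) × SimpleGraph (Fin N) × Fin h × Fin N))
    (R : Set (SimpleGraph (Fin (h + N)))) (Q : SimpleGraph (Fin (h + N)) → Set (Set (Fin (h + N))))
    (hQ : ∀ G ∈ R, (Q G).ncard ≤ D)
    (hT : ∀ t ∈ T, ∀ e : Fin h ⊕ Fin N ≃ Fin (h + N),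
      attachAt e t.1 t.2.1 t.2.2.1 t.2.2.2 ∈ R ∧
        (Set.range fun x => e (.inl x)) ∈ Q (attachAt e t.1 t.2.1 t.2.2.1 t.2.2.2)) :
    (h + N).choose h * T.ncard ≤ R.ncard * D := by
  classical
  have hex : ∀ S : Finset (Fin (h + N)), S.card = h →
      ∃ e : Fin h ⊕ Fin N ≃ Fin (h + N), (Set.range fun x => e (.inl x)) = S := by
    intro S hS
    have hS' : Sᶜ.card = N := by rw [Finset.card_compl, hS, Fintype.card_fin]; omega
    refine ⟨finSumEquivOfFinset hS hS', ?_⟩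
    rw [← S.range_orderEmbOfFin hS]
    congr 1
  have : Nonempty (Fin h ⊕ Fin N ≃ Fin (h + N)) := ⟨finSumFinEquiv⟩
  choose! e he using hex
  let F := (Finset.univ.powersetCard h : Finset (Finset (Fin (h + N)))) ×ˢ T.toFinite.toFinset
  let Z := R.toFinite.toFinset.sigma fun G => (Q G).toFinite.toFinset
  have hF : F.card = (h + N).choose h * T.ncard := by
    rw [Finset.card_product, Finset.card_powersetCard, Finset.card_univ, Fintype.card_fin,
      Set.ncard_eq_toFinset_card T]
  have hZ : Z.card ≤ R.ncard * D := by
    rw [Finset.card_sigma, Set.ncard_eq_toFinset_card R]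
    refine Finset.sum_le_card_nsmul _ _ _ fun G hG => ?_
    rw [← Set.ncard_eq_toFinset_card]
    exact hQ G (by simpa using hG)
  rw [← hF]
  refine le_trans (Finset.card_le_card_of_injOn
    (fun p => (⟨attachAt (e p.1) p.2.1 p.2.2.1 p.2.2.2.1 p.2.2.2.2, (p.1 : Set (Fin (h + N)))⟩ :
      (_ : SimpleGraph (Fin (h + N))) × Set (Fin (h + N)))) ?_ ?_) hZ
  · rintro ⟨S, t⟩ hp
    have hp' : S.card = h ∧ t ∈ T := by simpa [F] using hp
    have := hT t hp'.2 (e S)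
    rw [he S hp'.1] at this
    simpa [Z] using this
  · rintro ⟨S, A, B, u, v⟩ - ⟨S', A', B', u', v'⟩ - hpp
    simp only [Sigma.mk.injEq, heq_eq_eq, Finset.coe_inj] at hpp
    obtain ⟨h1, rfl⟩ := hpp
    obtain ⟨rfl, rfl, rfl, rfl⟩ := attachAt_injective h1
    rfl

end SimpleGraph

namespace GraphClass

open SimpleGraph

variable {C : GraphClass}

theorem Addable.attachAt_mem (hC : C.Addable) {X Y V : Type} [Finite X] [Finite Y] [Finite V]
    (e : X ⊕ Y ≃ V) {A : SimpleGraph X} {B : SimpleGraph Y} (hA : (C ∩ conn).Mem X A)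
    (hB : (C ∩ conn).Mem Y B) (u : X) (v : Y) : (C ∩ conn).Mem V (attachAt e A B u v) :=
  mem_of_iso (attachAtIso e A B u v) (hC.mem_glue hA hB u v)

/-- Two connected graphs are joined by an edge. Conversely a connected graph on `i + j` vertices has
at most `i + j` cuts of the required shape, since their small sides are disjoint. -/
theorem Addable.choose_mul_ncard_le (hC : C.Addable) {i j : ℕ} (hi : 1 ≤ i) (hij : i ≤ j) :
    (i + j).choose i * (((C ∩ conn).onFin i).ncard * (((C ∩ conn).onFin j).ncard * (i * j))) ≤
      ((C ∩ conn).onFin (i + j)).ncard * (i + j) := by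
  have hT : ((C ∩ conn).onFin i ×ˢ (C ∩ conn).onFin j ×ˢ (Set.univ : Set (Fin i)) ×ˢ
      (Set.univ : Set (Fin j))).ncard =
      ((C ∩ conn).onFin i).ncard * (((C ∩ conn).onFin j).ncard * (i * j)) := by
    simp [Set.ncard_prod, Set.ncard_univ]
  rw [← hT]
  let Q : SimpleGraph (Fin (i + j)) → Set (Set (Fin (i + j))) := fun G =>
    {S | S.ncard = i ∧ (G.induce S).Preconnected ∧ (G.induce Sᶜ).Preconnected ∧ G.CutAtMostOne S}
  refine SimpleGraph.choose_mul_ncard_le _ _ Q (fun G _ => ?_) ?_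
  · have hne : ∀ S ∈ Q G, S.Nonempty := fun S hS =>
      Set.nonempty_of_ncard_ne_zero (by have := hS.1; omega)
    have hpos : Nonempty (Fin (i + j)) := ⟨⟨0, by omega⟩⟩
    choose! g hg using hne
    have := Set.ncard_le_ncard_of_injOn (t := Set.univ) g (fun S _ => Set.mem_univ _)
      (s := Q G) (fun S hS S' hS' hSS' => by
        have hcompl : S.ncard ≤ Sᶜ.ncard := by
          have := Set.ncard_add_ncard_compl S
          rw [Nat.card_fin] at this
          have := hS.1
          omega
        rcases hS'.2.2.2.eq_or_disjoint hS.2.1 hS.2.2.1 (hS'.1.trans hS.1.symm) hcompl with h | h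
        · exact h.symm
        · exact absurd (hSS' ▸ hg S' hS') (Set.disjoint_left.1 h (hg S hS)))
    simpa [Set.ncard_univ] using this
  · rintro ⟨A, B, u, v⟩ ⟨hA, hB, -, -⟩ e
    refine ⟨hC.attachAt_mem e hA hB u v, ?_, (induce_attachAt_left hA.2).preconnected,
      (induce_attachAt_right hB.2).preconnected, cutAtMostOne_attachAt⟩
    exact (ncard_range_of_injective (e.injective.comp Sum.inl_injective)).trans (Nat.card_fin i)

end GraphClass

namespace SimpleGraph

variable {V W Y : Type}

/-- The vertex sets of the pendant copies in `G` of the rooted graph `(H, r)`. -/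
def pendantSets (H : SimpleGraph W) (r : W) (G : SimpleGraph V) : Set (Set V) :=
  {S | ∃ f : H ↪g G, IsPendant r f ∧ Set.range f = S}

/-- Attaching a copy of `H` to a connected graph creates no pendant copy except the new one: any
other one is disjoint from it. -/
theorem pendantSets_attachAt_subset [Finite W] [Finite Y] [Finite V] {H : SimpleGraph W} {r : W}
    (hH : H.Connected) {B : SimpleGraph Y} (hB : B.Connected) (hcard : Nat.card W ≤ Nat.card Y)
    (e : W ⊕ Y ≃ V) (v : Y) :
    pendantSets H r (attachAt e H B r v) ⊆
      insert (Set.range fun x => e (.inl x))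
        ((fun T => (fun y => e (.inr y)) '' T) '' pendantSets H r B) := by
  rintro _ ⟨f, ⟨v', hv'⟩, rfl⟩
  have hcut : (attachAt e H B r v).CutAtMostOne (Set.range f) := by
    refine ⟨f r, v', ?_⟩
    rintro _ ⟨w, rfl⟩ b hb hwb
    exact ⟨congrArg f (hv' w b hb hwb).1, (hv' w b hb hwb).2⟩
  have hn : (Set.range fun x => e (.inl x)).ncard = Nat.card W :=
    ncard_range_of_injective (e.injective.comp Sum.inl_injective)
  have hn' : (Set.range fun x => e (.inl x))ᶜ.ncard = Nat.card Y := by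
    rw [compl_range_inl]
    exact ncard_range_of_injective (e.injective.comp Sum.inr_injective)
  rcases hcut.eq_or_disjoint (induce_attachAt_left hH).preconnected
    (induce_attachAt_right hB).preconnected
    (by rw [hn, ncard_range_of_injective f.injective]) (by rw [hn, hn']; exact hcard) with h | h
  · exact Or.inl h
  · right
    have hy : ∀ w, ∃ y, e (.inr y) = f w := by
      intro w
      have : f w ∈ (Set.range fun x => e (.inl x))ᶜ := fun hw =>
        Set.disjoint_left.1 h hw ⟨w, rfl⟩
      rwa [compl_range_inl] at this
    choose g hg using hy
    have hginj : Function.Injective g := fun a b hab =>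
      f.injective (by rw [← hg, ← hg, hab])
    let g' : H ↪g B := ⟨⟨g, hginj⟩, fun {a b} => by
      rw [← f.map_adj_iff, ← hg, ← hg, attachAt_adj]; rfl⟩
    have hrange : (fun y => e (.inr y)) '' Set.range g' = Set.range f := by
      rw [← Set.range_comp]
      exact congrArg Set.range (funext hg)
    refine ⟨Set.range g', ⟨g', ?_, rfl⟩, hrange⟩
    have hout : ∀ w, ∀ b ∉ Set.range g', B.Adj (g' w) b → w = r ∧ e (.inr b) = v' := by
      intro w b hb hwb
      refine hv' w _ ?_ ?_
      · rintro ⟨w', hw'⟩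
        refine hb ⟨w', ?_⟩
        rw [← hg] at hw'
        exact Sum.inr_injective (e.injective hw')
      · rw [← hg, attachAt_adj]
        exact hwb
    obtain ⟨x | y, rfl⟩ := e.surjective v'
    · exact ⟨g r, fun w b hb hwb =>
        absurd (e.injective (hout w b hb hwb).2) Sum.inr_ne_inl⟩
    · exact ⟨y, fun w b hb hwb => ⟨(hout w b hb hwb).1,
        Sum.inr_injective (e.injective (hout w b hb hwb).2)⟩⟩

theorem ncard_pendantSets_attachAt_le [Finite W] [Finite Y] [Finite V] {H : SimpleGraph W} {r : W}
    (hH : H.Connected) {B : SimpleGraph Y} (hB : B.Connected) (hcard : Nat.card W ≤ Nat.card Y)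
    (e : W ⊕ Y ≃ V) (v : Y) :
    (pendantSets H r (attachAt e H B r v)).ncard ≤ (pendantSets H r B).ncard + 1 :=
  (Set.ncard_le_ncard (pendantSets_attachAt_subset hH hB hcard e v)).trans <|
    (Set.ncard_insert_le _ _).trans (Nat.add_le_add_right (Set.ncard_image_le) 1)

theorem range_mem_pendantSets_attachAt {H : SimpleGraph W} {r : W} {B : SimpleGraph Y}
    (e : W ⊕ Y ≃ V) (v : Y) :
    (Set.range fun x => e (.inl x)) ∈ pendantSets H r (attachAt e H B r v) := by
  refine ⟨⟨⟨fun x => e (.inl x), e.injective.comp Sum.inl_injective⟩, attachAt_adj⟩,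
    ⟨e (.inr v), ?_⟩, rfl⟩
  intro w b hb hwb
  obtain ⟨x | y, rfl⟩ := e.surjective b
  · exact absurd ⟨x, rfl⟩ hb
  · obtain ⟨rfl, rfl⟩ := attachAt_adj.1 hwb
    exact ⟨rfl, rfl⟩

end SimpleGraph

namespace GraphClass

open SimpleGraph

variable {C : GraphClass}

/-- The connected graphs of the class on `Fin n` with at most `p` pendant copies of `(H, r)`. -/
def fewPendants (C : GraphClass) {h : ℕ} (H : SimpleGraph (Fin h)) (r : Fin h) (p n : ℕ) :
    Set (SimpleGraph (Fin n)) :=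
  {G | G ∈ (C ∩ conn).onFin n ∧ (pendantSets H r G).ncard ≤ p}

theorem Addable.choose_mul_ncard_fewPendants_le (hC : C.Addable) {h : ℕ} {H : SimpleGraph (Fin h)}
    {r : Fin h} (hH : (C ∩ conn).Mem (Fin h) H) {N p : ℕ} (hN : h ≤ N) :
    (h + N).choose h * ((C.fewPendants H r p N).ncard * N) ≤
      (C.fewPendants H r (p + 1) (h + N)).ncard * (p + 1) := by
  have hT : (({H} : Set (SimpleGraph (Fin h))) ×ˢ C.fewPendants H r p N ×ˢ ({r} : Set (Fin h)) ×ˢ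
      (Set.univ : Set (Fin N))).ncard = (C.fewPendants H r p N).ncard * N := by
    simp [Set.ncard_prod, Set.ncard_univ]
  rw [← hT]
  refine SimpleGraph.choose_mul_ncard_le _ _ (pendantSets H r) (fun G hG => hG.2) ?_
  rintro ⟨A, B, u, v⟩ ⟨hA, hB, hu, -⟩ e
  simp only [Set.mem_singleton_iff] at hA hu
  subst hA hu
  refine ⟨⟨hC.attachAt_mem e hH hB.1 _ v, ?_⟩, range_mem_pendantSets_attachAt e v⟩
  exact (ncard_pendantSets_attachAt_le hH.2 hB.1.2 (by simpa using hN) e v).trans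
    (Nat.add_le_add_right hB.2 1)

end GraphClass

/-! ### Growth of supermultiplicative sequences -/

/-- A sequence that is supermultiplicative up to the factor `2` and at most exponential grows like
`γ ^ n` along the indices at which it is positive. No assumption is made on these indices; each
residue class modulo a well-chosen `m` is treated separately. -/
theorem exists_growth_rate {x : ℕ → ℝ} {d : ℝ} (hx : ∀ n, 0 ≤ x n) (hd : ∀ n, x n ≤ d ^ n)
    (hmul : ∀ i j, 1 ≤ i → 1 ≤ j → x i * x j ≤ 2 * x (i + j)) (hne : ∃ m, 1 ≤ m ∧ 0 < x m) :
    ∃ γ : ℝ, 0 < γ ∧ (∀ n, 1 ≤ n → x n ≤ 2 * γ ^ n) ∧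
      ∀ g, 0 < g → g < γ → ∃ c, 0 < c ∧ ∀ n, 1 ≤ n → 0 < x n → c * g ^ n ≤ x n := by
  set z : ℕ → ℝ := fun n => x n / 2 with hz
  have hz0 : ∀ n, 0 ≤ z n := fun n => by simp only [hz]; linarith [hx n]
  have hzmul : ∀ i j, 1 ≤ i → 1 ≤ j → z i * z j ≤ z (i + j) := fun i j hi hj => by
    simp only [hz]
    linarith [hmul i j hi hj]
  set S : Set ℝ := {t | ∃ n : ℕ, 1 ≤ n ∧ t = z n ^ (1 / n : ℝ)} with hS
  have hroot : ∀ (n : ℕ) (t : ℝ), 1 ≤ n → 0 ≤ t → (t ^ (1 / n : ℝ)) ^ n = t := fun n t hn ht => by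
    rw [one_div]
    exact Real.rpow_inv_natCast_pow ht (by omega)
  have hbdd : BddAbove S := by
    refine ⟨|d|, ?_⟩
    rintro _ ⟨n, hn, rfl⟩
    refine le_of_pow_le_pow_left₀ (n := n) (by omega) (abs_nonneg d) ?_
    rw [hroot n _ hn (hz0 n), ← abs_pow]
    exact le_trans (by simp only [hz]; linarith [hx n]) ((hd n).trans (le_abs_self _))
  have hmem : ∀ n : ℕ, 1 ≤ n → z n ^ (1 / n : ℝ) ≤ sSup S := fun n hn =>
    le_csSup hbdd ⟨n, hn, rfl⟩
  refine ⟨sSup S, ?_, fun n hn => ?_, fun g hg hgS => ?_⟩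
  · obtain ⟨m, hm, hxm⟩ := hne
    exact lt_of_lt_of_le (Real.rpow_pos_of_pos (by simp only [hz]; linarith) _) (hmem m hm)
  · have h1 := pow_le_pow_left₀ (Real.rpow_nonneg (hz0 n) _) (hmem n hn) n
    rw [hroot n _ hn (hz0 n)] at h1
    simp only [hz] at h1
    linarith
  · obtain ⟨m, hm, hxm⟩ := hne
    obtain ⟨_, ⟨m, hm, rfl⟩, hgm⟩ := exists_lt_of_lt_csSup (s := S) ⟨_, m, hm, rfl⟩ hgS
    have hgm' : g ^ m ≤ z m := by
      have := pow_le_pow_left₀ hg.le hgm.le m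
      rwa [hroot m _ hm (hz0 m)] at this
    have hiter : ∀ q r, 1 ≤ r → z m ^ q * z r ≤ z (r + m * q) := by
      intro q r hr
      induction q with
      | zero => simp
      | succ q ih =>
        calc z m ^ (q + 1) * z r = z m * (z m ^ q * z r) := by ring
          _ ≤ z m * z (r + m * q) := mul_le_mul_of_nonneg_left ih (hz0 m)
          _ ≤ z (m + (r + m * q)) := hzmul _ _ hm (by omega)
          _ = z (r + m * (q + 1)) := by congr 1; ring
    have hres : ∀ ρ : ℕ, ∃ c : ℝ, 0 < c ∧
        ∀ n, 1 ≤ n → 0 < x n → n % m = ρ → c * g ^ n ≤ x n := by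
      intro ρ
      classical
      by_cases hex : ∃ r, 1 ≤ r ∧ 0 < x r ∧ r % m = ρ
      · obtain ⟨hr, hxr, hrm⟩ := Nat.find_spec hex
        have hmin : ∀ n, 1 ≤ n → 0 < x n → n % m = ρ → Nat.find hex ≤ n :=
          fun n h1 h2 h3 => Nat.find_min' hex ⟨h1, h2, h3⟩
        generalize Nat.find hex = r at hr hxr hrm hmin
        refine ⟨z r / g ^ r, div_pos (by simp only [hz]; linarith) (by positivity), ?_⟩
        intro n hn hxn hnm
        have hle := hmin n hn hxn hnm
        obtain ⟨q, hq⟩ := (Nat.modEq_iff_dvd' hle).1 (hrm.trans hnm.symm)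
        have hnq : n = r + m * q := by omega
        calc z r / g ^ r * g ^ n = (g ^ m) ^ q * z r := by
              rw [hnq, pow_add, pow_mul]
              field_simp
          _ ≤ z m ^ q * z r := by gcongr
          _ ≤ z n := hnq ▸ hiter q r hr
          _ ≤ x n := by simp only [hz]; linarith
      · exact ⟨1, one_pos, fun n h1 h2 h3 => absurd ⟨n, h1, h2, h3⟩ hex⟩
    choose c hc hcn using hres
    have hm' : (Finset.range m).Nonempty := ⟨0, Finset.mem_range.2 hm⟩
    refine ⟨(Finset.range m).inf' hm' c, by simp [Finset.lt_inf'_iff, hc], fun n hn hxn => ?_⟩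
    refine le_trans ?_ (hcn (n % m) n hn hxn rfl)
    gcongr
    exact Finset.inf'_le _ (Finset.mem_range.2 (Nat.mod_lt _ (by omega)))

/-- If each element counted by `y` can be extended in `(a n) ^ p / p!` ways by `p` pieces of size `h`
to an element counted by `x`, for every `p`, then `y` is exponentially smaller than `x`. The choice
`p ≈ a n / (2 γ ^ h)` makes the gain at least `2 ^ p`. -/
theorem tendsto_div_of_extensions {x y : ℕ → ℝ} {d a : ℝ} {h : ℕ} (hx : ∀ n, 0 ≤ x n)
    (hy : ∀ n, 0 ≤ y n) (hd : ∀ n, x n ≤ d ^ n)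
    (hmul : ∀ i j, 1 ≤ i → 1 ≤ j → x i * x j ≤ 2 * x (i + j)) (hne : ∃ m, 1 ≤ m ∧ 0 < x m)
    (ha : 0 < a)
    (hxy : ∀ n p : ℕ, h ≤ n → y n * (a * n) ^ p ≤ x (h * p + n) * (p.factorial : ℝ)) :
    Tendsto (fun n => y n / x n) (atTop ⊓ 𝓟 {n | 0 < x n}) (𝓝 0) := by
  obtain ⟨γ, hγ, hup, hlow⟩ := exists_growth_rate hx hd hmul hne
  set β : ℝ := a / (2 * γ ^ h) with hβ
  have hβ0 : 0 < β := by positivity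
  set θ : ℝ := (1 / 2 : ℝ) ^ β with hθ
  have hθ0 : 0 < θ := by positivity
  have hθ1 : θ < 1 := Real.rpow_lt_one (by norm_num) (by norm_num) hβ0
  have hyup : ∀ n : ℕ, 1 ≤ n → h ≤ n → y n ≤ 4 * (γ * θ) ^ n := by
    intro n hn hhn
    have hn0 : (0 : ℝ) < n := by exact_mod_cast hn
    set p : ℕ := ⌊β * n⌋₊ with hp
    have hple : (p : ℝ) ≤ β * n := Nat.floor_le (by positivity)
    have hplt : β * n < p + 1 := Nat.lt_floor_add_one _
    have hfac : (p.factorial : ℝ) ≤ (p : ℝ) ^ p := by exact_mod_cast p.factorial_le_pow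
    have h1 : γ ^ h * p ≤ a * n * (1 / 2) := by
      calc γ ^ h * p ≤ γ ^ h * (β * n) := by gcongr
        _ = a * n * (1 / 2) := by rw [hβ]; field_simp
    have h2 : y n * (a * n) ^ p ≤ 2 * γ ^ n * (1 / 2) ^ p * (a * n) ^ p := by
      calc y n * (a * n) ^ p ≤ x (h * p + n) * (p.factorial : ℝ) := hxy n p hhn
        _ ≤ 2 * γ ^ (h * p + n) * (p : ℝ) ^ p :=
          mul_le_mul (hup _ (by omega)) hfac (by positivity) (by positivity)
        _ = 2 * γ ^ n * (γ ^ h * p) ^ p := by rw [pow_add, pow_mul, mul_pow]; ring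
        _ ≤ 2 * γ ^ n * (a * n * (1 / 2)) ^ p := by gcongr
        _ = 2 * γ ^ n * (1 / 2) ^ p * (a * n) ^ p := by rw [mul_pow (a * n)]; ring
    have h3 : y n ≤ 2 * γ ^ n * (1 / 2) ^ p := le_of_mul_le_mul_right h2 (by positivity)
    have h4 : ((1 / 2 : ℝ)) ^ p ≤ 2 * θ ^ n := by
      have : θ ^ n = (1 / 2 : ℝ) ^ (β * n) := by
        rw [hθ, ← Real.rpow_natCast, ← Real.rpow_mul (by norm_num)]
      rw [this]
      have h5 : (1 / 2 : ℝ) ^ ((p : ℝ) + 1) ≤ (1 / 2 : ℝ) ^ (β * n) :=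
        Real.rpow_le_rpow_of_exponent_ge (by norm_num) (by norm_num) hplt.le
      rw [Real.rpow_add (by norm_num), Real.rpow_natCast, Real.rpow_one] at h5
      linarith
    calc y n ≤ 2 * γ ^ n * (1 / 2) ^ p := h3
      _ ≤ 2 * γ ^ n * (2 * θ ^ n) := by gcongr
      _ = 4 * (γ * θ) ^ n := by rw [mul_pow]; ring
  set g : ℝ := γ * ((1 + θ) / 2) with hg
  have hg0 : 0 < g := by positivity
  have hgγ : g < γ := by
    rw [hg]
    exact mul_lt_of_lt_one_right hγ (by linarith)
  obtain ⟨c, hc, hcn⟩ := hlow g hg0 hgγ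
  have hlim : Tendsto (fun n : ℕ => 4 / c * (γ * θ / g) ^ n) atTop (𝓝 0) := by
    have : γ * θ / g < 1 := by
      rw [div_lt_one hg0, hg]
      exact mul_lt_mul_of_pos_left (by linarith) hγ
    simpa using (tendsto_pow_atTop_nhds_zero_of_lt_one (by positivity) this).const_mul (4 / c)
  refine tendsto_of_tendsto_of_tendsto_of_le_of_le' tendsto_const_nhds
    (hlim.mono_left inf_le_left) (Eventually.of_forall fun n => div_nonneg (hy n) (hx n)) ?_
  rw [eventually_inf_principal]
  filter_upwards [eventually_ge_atTop (max 1 h)] with n hn hxn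
  have hn1 : 1 ≤ n := (le_max_left _ _).trans hn
  calc y n / x n ≤ 4 * (γ * θ) ^ n / (c * g ^ n) :=
        div_le_div₀ (by positivity) (hyup n hn1 ((le_max_right _ _).trans hn)) (by positivity)
          (hcn n hn1 hxn)
    _ = 4 / c * (γ * θ / g) ^ n := by rw [div_pow]; field_simp

/-! ### The zero-one law -/

namespace GraphClass

open SimpleGraph

variable {C : GraphClass}

/-- The number of connected graphs of the class on `n` labelled vertices, divided by `n!`. -/
noncomputable def connDensity (C : GraphClass) (n : ℕ) : ℝ :=
  ((C ∩ conn).onFin n).ncard / (n.factorial : ℝ)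

/-- The number of connected graphs of the class on `n` labelled vertices with at most `p` pendant
copies of `(H, r)`, divided by `n!`. -/
noncomputable def fewDensity (C : GraphClass) {h : ℕ} (H : SimpleGraph (Fin h)) (r : Fin h)
    (p n : ℕ) : ℝ :=
  (C.fewPendants H r p n).ncard / (n.factorial : ℝ)

theorem connDensity_nonneg (C : GraphClass) (n : ℕ) : 0 ≤ C.connDensity n := by
  unfold connDensity
  positivity

theorem connDensity_pos_iff {n : ℕ} : 0 < C.connDensity n ↔ n ∈ (C ∩ conn).sizes := by
  unfold connDensity
  rw [div_pos_iff_of_pos_right (by positivity), Nat.cast_pos, Set.ncard_pos]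
  rfl

theorem fewDensity_nonneg (C : GraphClass) {h : ℕ} (H : SimpleGraph (Fin h)) (r : Fin h)
    (p n : ℕ) : 0 ≤ C.fewDensity H r p n := by
  unfold fewDensity
  positivity

theorem fewDensity_le_connDensity (C : GraphClass) {h : ℕ} (H : SimpleGraph (Fin h)) (r : Fin h)
    (p n : ℕ) : C.fewDensity H r p n ≤ C.connDensity n := by
  unfold fewDensity connDensity
  gcongr
  · exact Set.toFinite _
  · exact fun G hG => hG.1

theorem Small.exists_connDensity_le (hC : C.Small) : ∃ d : ℝ, ∀ n, C.connDensity n ≤ d ^ n := by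
  obtain ⟨d, hd⟩ := hC
  refine ⟨d, fun n => ?_⟩
  unfold connDensity
  rw [div_le_iff₀ (by positivity)]
  refine le_trans ?_ (hd n)
  exact_mod_cast Set.ncard_le_ncard (t := C.onFin n) (fun G hG => And.left hG) (Set.toFinite _)

theorem cast_choose_eq (i j : ℕ) : ((i + j).choose i : ℝ) =
    ((i + j).factorial : ℝ) / ((i.factorial : ℝ) * (j.factorial : ℝ)) := by
  rw [eq_div_iff (by positivity), ← mul_assoc]
  have := Nat.add_choose_mul_factorial_mul_factorial i j
  rw [← Nat.choose_symm_add] at this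
  exact_mod_cast this

theorem Addable.connDensity_mul_le (hC : C.Addable) {i j : ℕ} (hi : 1 ≤ i) (hj : 1 ≤ j) :
    C.connDensity i * C.connDensity j ≤ 2 * C.connDensity (i + j) := by
  wlog hij : i ≤ j generalizing i j
  · rw [mul_comm, add_comm]
    exact this hj hi (by omega)
  have h1 : ((i + j).choose i : ℝ) * (((C ∩ conn).onFin i).ncard *
      (((C ∩ conn).onFin j).ncard * (i * j))) ≤
      ((C ∩ conn).onFin (i + j)).ncard * (i + j) := by
    exact_mod_cast hC.choose_mul_ncard_le hi hij
  have hi' : (1 : ℝ) ≤ i := by exact_mod_cast hi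
  have hj' : (1 : ℝ) ≤ j := by exact_mod_cast hj
  have h2 : (i : ℝ) + j ≤ 2 * (i * j) := by nlinarith
  have h3 : ((C ∩ conn).onFin (i + j)).ncard * ((i : ℝ) + j) ≤
      ((C ∩ conn).onFin (i + j)).ncard * (2 * (i * j)) := by gcongr
  unfold connDensity
  rw [cast_choose_eq] at h1
  have h4 := h1.trans h3
  have hpos : 0 < (i * j : ℝ) * (i + j).factorial := by positivity
  refine le_of_mul_le_mul_right ?_ hpos
  calc _ = ((i + j).factorial : ℝ) / ((i.factorial : ℝ) * (j.factorial : ℝ)) *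
        (((C ∩ conn).onFin i).ncard * (((C ∩ conn).onFin j).ncard * (i * j))) := by
        field_simp
    _ ≤ ((C ∩ conn).onFin (i + j)).ncard * (2 * (i * j)) := h4
    _ = _ := by field_simp

theorem Addable.fewDensity_mul_le (hC : C.Addable) {h : ℕ} {H : SimpleGraph (Fin h)}
    {r : Fin h} (hH : (C ∩ conn).Mem (Fin h) H) {N p : ℕ} (hN : h ≤ N) :
    C.fewDensity H r p N * (1 / (h.factorial : ℝ) * N) ≤
      C.fewDensity H r (p + 1) (h + N) * (p + 1) := by
  have h1 : ((h + N).choose h : ℝ) * ((C.fewPendants H r p N).ncard * N) ≤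
      (C.fewPendants H r (p + 1) (h + N)).ncard * (p + 1) := by
    exact_mod_cast hC.choose_mul_ncard_fewPendants_le hH hN
  unfold fewDensity
  rw [cast_choose_eq] at h1
  refine le_of_mul_le_mul_right ?_ (by positivity : (0 : ℝ) < (h + N).factorial)
  calc _ = ((h + N).factorial : ℝ) / ((h.factorial : ℝ) * (N.factorial : ℝ)) *
        ((C.fewPendants H r p N).ncard * N) := by field_simp
    _ ≤ _ := h1
    _ = _ := by field_simp

theorem Addable.fewDensity_zero_mul_pow_le (hC : C.Addable) {h : ℕ} {H : SimpleGraph (Fin h)}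
    {r : Fin h} (hH : (C ∩ conn).Mem (Fin h) H) {n : ℕ} (hn : h ≤ n) (p : ℕ) :
    C.fewDensity H r 0 n * (1 / (h.factorial : ℝ) * n) ^ p ≤
      C.fewDensity H r p (h * p + n) * (p.factorial : ℝ) := by
  induction p with
  | zero => simp
  | succ p ih =>
    calc C.fewDensity H r 0 n * (1 / (h.factorial : ℝ) * n) ^ (p + 1)
        = C.fewDensity H r 0 n * (1 / (h.factorial : ℝ) * n) ^ p *
          (1 / (h.factorial : ℝ) * n) := by ring
      _ ≤ C.fewDensity H r p (h * p + n) * (p.factorial : ℝ) *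
          (1 / (h.factorial : ℝ) * (h * p + n : ℕ)) := by
        gcongr
        · exact mul_nonneg (fewDensity_nonneg _ _ _ _ _) (by positivity)
        · exact Nat.le_add_left _ _
      _ = C.fewDensity H r p (h * p + n) * (1 / (h.factorial : ℝ) * (h * p + n : ℕ)) *
          (p.factorial : ℝ) := by ring
      _ ≤ C.fewDensity H r (p + 1) (h + (h * p + n)) * (p + 1) * (p.factorial : ℝ) :=
        mul_le_mul_of_nonneg_right (hC.fewDensity_mul_le hH (by omega)) (by positivity)
      _ = C.fewDensity H r (p + 1) (h * (p + 1) + n) * ((p + 1).factorial : ℝ) := by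
        rw [Nat.factorial_succ, show h + (h * p + n) = h * (p + 1) + n by ring]
        push_cast
        ring

theorem Addable.exists_mem_sizes (hC : C.Addable)
    (hne : ∃ (V : Type) (_ : Finite V) (_ : Nonempty V) (G : SimpleGraph V), C.Mem V G) :
    ∃ m, 1 ≤ m ∧ 0 < C.connDensity m := by
  obtain ⟨V, _, G, hG⟩ := hC.exists_mem_conn hne
  obtain ⟨m, ⟨e⟩⟩ := Finite.exists_equiv_fin V
  obtain ⟨v⟩ := hG.2.nonempty
  exact ⟨m, (e v).pos, connDensity_pos_iff.2 ⟨_, mem_of_iso (Iso.map e G) hG⟩⟩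

theorem Addable.sizes_infinite (hC : C.Addable)
    (hne : ∃ (V : Type) (_ : Finite V) (_ : Nonempty V) (G : SimpleGraph V), C.Mem V G) :
    (C ∩ conn).sizes.Infinite := by
  obtain ⟨m, hm, hpos⟩ := hC.exists_mem_sizes hne
  have hmul : ∀ q : ℕ, 0 < C.connDensity (m * (q + 1)) := by
    intro q
    induction q with
    | zero => simpa using hpos
    | succ q ih =>
      have := hC.connDensity_mul_le (i := m * (q + 1)) (j := m) (Nat.mul_pos hm q.succ_pos) hm
      have := mul_pos ih hpos
      rw [mul_add_one m (q + 1)]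
      linarith
  refine Set.infinite_of_forall_exists_gt fun a => ⟨m * (a + 1), connDensity_pos_iff.1 (hmul a), ?_⟩
  nlinarith

/-- Almost every connected graph of a small addable class contains a pendant copy of a given rooted
connected member. -/
theorem Addable.tendsto_fewPendants (hC : C.Addable) (hsmall : C.Small) {h : ℕ}
    {H : SimpleGraph (Fin h)} (r : Fin h) (hH : (C ∩ conn).Mem (Fin h) H) :
    Tendsto (fun n => ((C.fewPendants H r 0 n).ncard : ℝ) / ((C ∩ conn).onFin n).ncard)
      (atTop ⊓ 𝓟 (C ∩ conn).sizes) (𝓝 0) := by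
  obtain ⟨d, hd⟩ := hsmall.exists_connDensity_le
  have key := tendsto_div_of_extensions (y := C.fewDensity H r 0) (h := h) C.connDensity_nonneg
    (C.fewDensity_nonneg H r 0) hd (fun i j => hC.connDensity_mul_le)
    ⟨h, r.pos, connDensity_pos_iff.2 ⟨H, hH⟩⟩ (by positivity : (0 : ℝ) < 1 / h.factorial)
    (fun n p hn => (hC.fewDensity_zero_mul_pow_le hH hn p).trans
      (mul_le_mul_of_nonneg_right (C.fewDensity_le_connDensity H r p _) (by positivity)))
  have hset : {n | 0 < C.connDensity n} = (C ∩ conn).sizes := Set.ext fun n => connDensity_pos_iff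
  rw [hset] at key
  refine key.congr fun n => ?_
  unfold fewDensity connDensity
  exact div_div_div_cancel_right₀ (by positivity) _ _

theorem exists_isPendant_of_notMem_fewPendants {h : ℕ} {H : SimpleGraph (Fin h)} {r : Fin h} {n : ℕ}
    {G : SimpleGraph (Fin n)} (hG : G ∈ (C ∩ conn).onFin n) (hG' : G ∉ C.fewPendants H r 0 n) :
    ∃ f : H ↪g G, IsPendant r f := by
  by_contra! hf
  refine hG' ⟨hG, ?_⟩
  have : pendantSets H r G = ∅ := Set.eq_empty_of_forall_notMem fun S ⟨f, h, _⟩ => hf f h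
  simp [this]

/-- If the graphs that violate `φ` are contained in sets of vanishing density, the probability of `φ`
tends to `1`. -/
theorem tendsto_prob_one {K : GraphClass} {φ : MSOFormula} (E : ∀ n, Set (SimpleGraph (Fin n)))
    (hE : Tendsto (fun n => ((E n).ncard : ℝ) / (K.onFin n).ncard) (atTop ⊓ 𝓟 K.sizes) (𝓝 0))
    (hsub : ∀ n, ∀ G ∈ K.onFin n, ¬ MSOFormula.Holds G φ → G ∈ E n) :
    Tendsto (fun n => K.prob φ n) (atTop ⊓ 𝓟 K.sizes) (𝓝 1) := by
  have hlow : Tendsto (fun n => 1 - ((E n).ncard : ℝ) / (K.onFin n).ncard)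
      (atTop ⊓ 𝓟 K.sizes) (𝓝 1) := by simpa using hE.const_sub 1
  refine tendsto_of_tendsto_of_tendsto_of_le_of_le' hlow tendsto_const_nhds ?_ ?_
  · rw [eventually_inf_principal]
    refine Eventually.of_forall fun n hn => ?_
    have hpos : (0 : ℝ) < (K.onFin n).ncard := by
      exact_mod_cast (Set.ncard_pos (Set.toFinite _)).2 hn
    have hle : (K.onFin n).ncard ≤
        {G | G ∈ K.onFin n ∧ MSOFormula.Holds G φ}.ncard + (E n).ncard := by
      refine (Set.ncard_le_ncard (fun G hG => ?_) (Set.toFinite _)).trans (Set.ncard_union_le _ _)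
      by_cases h : MSOFormula.Holds G φ
      · exact Or.inl ⟨hG, h⟩
      · exact Or.inr (hsub n G hG h)
    have hle' : ((K.onFin n).ncard : ℝ) ≤
        ({G | G ∈ K.onFin n ∧ MSOFormula.Holds G φ}.ncard : ℝ) + (E n).ncard := by
      exact_mod_cast hle
    unfold prob
    rw [sub_le_iff_le_add, ← add_div, le_div_iff₀ hpos, one_mul]
    exact hle'
  · refine Eventually.of_forall fun n => div_le_one_of_le₀ ?_ (by positivity)
    exact_mod_cast Set.ncard_le_ncard (t := K.onFin n) (fun G hG => And.left hG) (Set.toFinite _)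

/-- If the graphs that satisfy `φ` are contained in sets of vanishing density, the probability of `φ`
tends to `0`. -/
theorem tendsto_prob_zero {K : GraphClass} {φ : MSOFormula} (E : ∀ n, Set (SimpleGraph (Fin n)))
    (hE : Tendsto (fun n => ((E n).ncard : ℝ) / (K.onFin n).ncard) (atTop ⊓ 𝓟 K.sizes) (𝓝 0))
    (hsub : ∀ n, ∀ G ∈ K.onFin n, MSOFormula.Holds G φ → G ∈ E n) :
    Tendsto (fun n => K.prob φ n) (atTop ⊓ 𝓟 K.sizes) (𝓝 0) := by
  refine squeeze_zero (fun n => div_nonneg (by positivity) (by positivity)) (fun n => ?_) hE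
  unfold prob
  gcongr
  · exact Set.toFinite _
  · exact fun G hG => hsub n G hG.1 hG.2

end GraphClass

theorem mainTheorem1 (C : GraphClass) (hsmall : C.Small) (hadd : C.Addable)
    (hne : ∃ (V : Type) (_ : Finite V) (_ : Nonempty V) (G : SimpleGraph V), C.Mem V G)
    (φ : MSOFormula) (hφ : φ.IsSentence) :
    (C ∩ GraphClass.conn).sizes.Infinite ∧
      (Tendsto (fun n : ℕ => (C ∩ GraphClass.conn).prob φ n)
          (atTop ⊓ 𝓟 (C ∩ GraphClass.conn).sizes) (𝓝 0) ∨
        Tendsto (fun n : ℕ => (C ∩ GraphClass.conn).prob φ n)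
          (atTop ⊓ 𝓟 (C ∩ GraphClass.conn).sizes) (𝓝 1)) := by
  refine ⟨hadd.sizes_infinite hne, ?_⟩
  obtain ⟨h, H, r, hH, huniv⟩ :=
    hadd.exists_universal_pendant (hadd.exists_mem_conn hne) (φ.rank + 1)
  have hE := hadd.tendsto_fewPendants hsmall r hH
  by_cases hex : ∃ (n : ℕ) (G : SimpleGraph (Fin n)) (f : H ↪g G),
      (C ∩ GraphClass.conn).Mem (Fin n) G ∧ SimpleGraph.IsPendant r f ∧ MSOFormula.Holds G φ
  -- All graphs with a pendant copy of `H` agree on `φ`, so the limit depends on whether one of them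
  -- satisfies `φ`.
  · obtain ⟨n₀, G₀, f₀, hG₀, hf₀, hφ₀⟩ := hex
    refine Or.inr (GraphClass.tendsto_prob_one _ hE fun n G hG hGφ => ?_)
    by_contra hG'
    obtain ⟨f, hf⟩ := GraphClass.exists_isPendant_of_notMem_fewPendants hG hG'
    exact hGφ ((MSOFormula.holds_iff_of_msoType_eq le_rfl
      (huniv _ _ G₀ G f₀ f hG₀ hG hf₀ hf)).1 hφ₀)
  · refine Or.inl (GraphClass.tendsto_prob_zero _ hE fun n G hG hGφ => ?_)
    by_contra hG'
    obtain ⟨f, hf⟩ := GraphClass.exists_isPendant_of_notMem_fewPendants hG hG'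
    exact hex ⟨n, G, f, hG, hf, hGφ⟩
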